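/- A \emph{hypergraph} over a set $V$ of vertices and a ranked alphabet $F$ is a set of hyperarcs $f v_1\cdots v_n$ with $f\in F$ of arity $n$ and $v_1,\dots,v_n\in V$; its vertex set consists of the vertices that occur on its hyperarcs. A \emph{hypergraph grammar} is a tuple $G=(N,T,R,Z)$, where $N$ and $T=T_1\cup T_2$ are finite ranked alphabets of non-terminals and terminals, the terminals having arity one (colours, $T_1$) or two (arc labels, $T_2$), $Z\in N$ has arity $0$, and $R$ assigns to each $A\in N$ of arity $\rho(A)$ a pair $(H_A,\iota_A)$ of a finite hypergraph $H_A$ over $N\cup T$ and an injective map $\iota_A$ from $\{1,\dots,\rho(A)\}$ into the vertices of $H_A$. In a complete parallel rewriting $M\Rightarrow_R M'$ of a hypergraph $M$, all non-terminal hyperarcs $X=Av_1\cdots v_{\rho(A)}$ of $M$ are simultaneously replaced by copies $h_X(H_A)$, where $h_X$ maps $\iota_A(i)$ to $v_i$ and maps the other vertices of $H_A$ injectively to vertices outside $M$, the new vertices of different copies being different. Write $[M]$ for the set of terminal hyperarcs of $M$. The graphs generated by $G$ are the unions $\bigcup_{n\ge 0}[M_n]$ over the sequences $M_0=\{Z\}$,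 $M_n\Rightarrow_R M_{n+1}$ $(n\ge 0)$; they are all isomorphic. For a vertex $v$ of a generated graph and $a\in T_2$, let $\#(v,a)$ be the number of vertices $v'$ with an $a$-labelled arc from $v$ to $v'$. Let $\mu$ be a map from $T_2$ to $[0,1]$. The pair $(G,\mu)$ is a \emph{probabilistic hypergraph grammar} if for each vertex $v$ of a generated graph all the numbers $\#(v,a)$ are finite and $\sum_{a\in T_2}\mu(a)\,\#(v,a)=1$. \textbf{Proposition.} Given a hypergraph grammar $G$ and a map $\mu:T_2\to[0,1]$ with rational values, it is decidable whether $(G,\mu)$ is a probabilistic hypergraph grammar. More generally, suppose that the values of $\mu$ are written in any notation for real numbers in which it is decidable whether a given number lies in $[0,1]$, and whether $\sum_i n_i x_i=1$ for a given finite list of natural numbers $n_i$ and given numbers $x_i$. Then it is decidable, given $G$ and $\mu$, whether $(G,\mu)$ is a probabilistic hypergraph grammar. -/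

import Mathlib

/-- The symbols of a hypergraph grammar: non-terminals, terminals of arity two (arc labels)
and terminals of arity one (colours). All alphabets are finite, and their letters are numbered. -/
inductive HRSymbol where
  | nonterminal (A : ℕ) : HRSymbol
  | arcLabel (a : ℕ) : HRSymbol
  | colour (c : ℕ) : HRSymbol

/-- A hyperarc `f v₁ ⋯ vₙ` over the vertex set `ℕ`: a symbol and a tuple of vertices. -/
abbrev Hyperarc : Type := HRSymbol × List ℕ

/-- The vertices of a hypergraph (a set of hyperarcs) are the vertices that occur on
one of its hyperarcs. -/
def hyperVertices (H : Set Hyperarc) : Set ℕ := {v | ∃ X ∈ H, v ∈ X.2}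

/-- `[H]`: the terminal arcs and colours of `H`. -/
def terminalPart (H : Set Hyperarc) : Set Hyperarc :=
  {X | X ∈ H ∧ ∀ A, X.1 ≠ HRSymbol.nonterminal A}

/-- The image of a hyperarc under a map of vertices. -/
def Hyperarc.mapVertices (h : ℕ → ℕ) (X : Hyperarc) : Hyperarc := (X.1, X.2.map h)

/-- The finite data of a hypergraph grammar `(N, T, R, Z)`.
* `N = {0, …, rules.length - 1}`, and entry number `A` of `rules` is the rule `(H_A, ι_A)`:
  a list of the hyperarcs of `H_A`, and the list `ι_A(1), …, ι_A(ρ(A))`;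
* `T₂ = {0, …, arcLabels - 1}` and `T₁ = {0, …, colours - 1}`;
* `start` is the non-terminal `Z`.

The conditions that these data have to satisfy are in `HRGrammar.IsValid`. -/
structure HRGrammar where
  rules : List (List Hyperarc × List ℕ)
  arcLabels : ℕ
  colours : ℕ
  start : ℕ

namespace HRGrammar

/-- The right-hand side `H_A`, a finite set of hyperarcs. -/
def rhs (G : HRGrammar) (A : ℕ) : Set Hyperarc :=
  {X | X ∈ (G.rules.getD A ([], [])).1}

/-- The tuple `ι_A(1), …, ι_A(ρ(A))` of inputs of `H_A`. -/
def inputs (G : HRGrammar) (A : ℕ) : List ℕ := (G.rules.getD A ([], [])).2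

/-- The arity `ρ(A)` of the non-terminal `A`. -/
def arity (G : HRGrammar) (A : ℕ) : ℕ := (G.inputs A).length

/-- The vertices of `H_A` that are not inputs. -/
def innerVertices (G : HRGrammar) (A : ℕ) : Set ℕ :=
  {w | w ∈ hyperVertices (G.rhs A) ∧ w ∉ G.inputs A}

/-- The label of the hyperarc is a symbol of `G`, and the number of vertices is its arity. -/
def IsHyperarc (G : HRGrammar) (X : Hyperarc) : Prop :=
  match X.1 with
  | HRSymbol.nonterminal B => B < G.rules.length ∧ X.2.length = G.arity B
  | HRSymbol.arcLabel a => a < G.arcLabels ∧ X.2.length = 2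
  | HRSymbol.colour c => c < G.colours ∧ X.2.length = 1

/-- The data are those of a hypergraph grammar: `Z` is a non-terminal of arity `0`, each `H_A` is a
hypergraph over `N ∪ T`, and each `ι_A` is injective with values in the vertices of `H_A`. -/
structure IsValid (G : HRGrammar) : Prop where
  start_mem : G.start < G.rules.length
  start_arity : G.arity G.start = 0
  rhs_isHyperarc : ∀ A < G.rules.length, ∀ X ∈ G.rhs A, G.IsHyperarc X
  inputs_injective : ∀ A < G.rules.length, (G.inputs A).Nodup
  inputs_mem : ∀ A < G.rules.length, ∀ v ∈ G.inputs A, v ∈ hyperVertices (G.rhs A)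

/-- `h` is a map along which the hyperarc `A v₁ ⋯ vₚ` of `M` may be replaced by `h(H_A)`:
it maps `ι_A(i)` to `vᵢ`, and maps the other vertices of `H_A` injectively to vertices outside `M`.
If the `vᵢ` are distinct, this says that `h` is injective on all the vertices of `H_A`. -/
structure IsReplacement (G : HRGrammar) (M : Set Hyperarc) (A : ℕ) (vs : List ℕ)
    (h : ℕ → ℕ) : Prop where
  map_inputs : (G.inputs A).map h = vs
  injOn : Set.InjOn h (G.innerVertices A)
  fresh : ∀ w ∈ G.innerVertices A, h w ∉ hyperVertices M

/-- Complete parallel rewriting: all non-terminal hyperarcs `A vs` of `M` are replaced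
simultaneously, each one by a copy `h A vs (H_A)` of its right-hand side; the new vertices of
different copies are different. -/
def ParallelRewrites (G : HRGrammar) (M M' : Set Hyperarc) : Prop :=
  ∃ h : ℕ → List ℕ → ℕ → ℕ,
    (∀ A vs, (HRSymbol.nonterminal A, vs) ∈ M → G.IsReplacement M A vs (h A vs)) ∧
    (∀ A vs B ws, (HRSymbol.nonterminal A, vs) ∈ M → (HRSymbol.nonterminal B, ws) ∈ M →
      (A, vs) ≠ (B, ws) →
      Disjoint (h A vs '' G.innerVertices A) (h B ws '' G.innerVertices B)) ∧
    M' = terminalPart M ∪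
      {Y | ∃ A vs, (HRSymbol.nonterminal A, vs) ∈ M ∧
        ∃ X ∈ G.rhs A, Y = Hyperarc.mapVertices (h A vs) X}

/-- The set `G^ω` of the graphs generated by `G`: the unions of the terminal parts along
the infinite sequences of complete parallel rewritings that start with the hyperarc `Z`. -/
def generatedGraphs (G : HRGrammar) : Set (Set Hyperarc) :=
  {H | ∃ M : ℕ → Set Hyperarc, M 0 = {(HRSymbol.nonterminal G.start, [])} ∧
    (∀ n, G.ParallelRewrites (M n) (M (n + 1))) ∧ H = ⋃ n, terminalPart (M n)}

end HRGrammar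

/-- The targets of the `a`-labelled arcs from `v` in the graph `H`. -/
def arcTargets (H : Set Hyperarc) (v a : ℕ) : Set ℕ :=
  {v' | (HRSymbol.arcLabel a, [v, v']) ∈ H}

/-- `(G, μ)` is a probabilistic hypergraph grammar: `G` is a hypergraph grammar, `μ` maps the
arc labels to `[0, 1]`, and at each vertex `v` of a generated graph the numbers `#(v, a)` of
outgoing `a`-labelled arcs are finite and satisfy `∑ a, μ(a) #(v, a) = 1`. -/
structure HRGrammar.IsProbabilistic (G : HRGrammar) (μ : Fin G.arcLabels → ℝ) : Prop where
  valid : G.IsValid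
  weight_mem : ∀ a, μ a ∈ Set.Icc (0 : ℝ) 1
  finite_arcs : ∀ H ∈ G.generatedGraphs, ∀ v ∈ hyperVertices H, ∀ a : Fin G.arcLabels,
    (arcTargets H v a).Finite
  sum_eq_one : ∀ H ∈ G.generatedGraphs, ∀ v ∈ hyperVertices H,
    ∑ a : Fin G.arcLabels, μ a * ((arcTargets H v a).ncard : ℝ) = 1

/-- The language of the decision problem. An instance is a grammar together with the list of
the weights of its arc labels, the weights being written in a notation `K` for real numbers
in which `k : K` denotes `val k`. -/
def IsPHRInstance {K : Type} (val : K → ℝ) (p : HRGrammar × List K) : Prop :=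
  ∃ hlen : p.2.length = p.1.arcLabels,
    p.1.IsProbabilistic (fun a => val (p.2.get (Fin.cast hlen.symm a)))

/-- The number denoted by a fraction: the pair `(m, d)` stands for `m / (d + 1)`. -/
noncomputable def fractionValue (q : ℕ × ℕ) : ℝ := (q.1 : ℝ) / ((q.2 : ℝ) + 1)

/-- Symbols as tagged numbers. -/
def HRSymbol.equivSum : HRSymbol ≃ ℕ ⊕ (ℕ ⊕ ℕ) where
  toFun
    | HRSymbol.nonterminal A => Sum.inl A
    | HRSymbol.arcLabel a => Sum.inr (Sum.inl a)
    | HRSymbol.colour c => Sum.inr (Sum.inr c)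
  invFun
    | Sum.inl A => HRSymbol.nonterminal A
    | Sum.inr (Sum.inl a) => HRSymbol.arcLabel a
    | Sum.inr (Sum.inr c) => HRSymbol.colour c
  left_inv x := by cases x <;> rfl
  right_inv x := by rcases x with _ | _ | _ <;> rfl

instance : Primcodable HRSymbol := Primcodable.ofEquiv _ HRSymbol.equivSum

/-- A grammar as the tuple of its fields. -/
def HRGrammar.equivProd :
    HRGrammar ≃ List (List Hyperarc × List ℕ) × ℕ × ℕ × ℕ where
  toFun G := (G.rules, G.arcLabels, G.colours, G.start)
  invFun t := ⟨t.1, t.2.1, t.2.2.1, t.2.2.2⟩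
  left_inv _ := rfl
  right_inv _ := rfl

instance : Primcodable HRGrammar := Primcodable.ofEquiv _ HRGrammar.equivProd

/-!
Two hyperarcs have the same type relative to a list of distinguished vertices if some bijection of
their vertices carries one to the other and fixes the distinguished ones. The hypergraphs that
descend from hyperarcs of the same type are isomorphic, stage by stage, and the hyperarcs over `G`
have at most `K = G.typeBound` types relative to at most two vertices. Hence everything that happens
to a type already happens within `K` steps of its first occurrence:

* all arcs at a vertex descend from the hyperarc whose rewriting creates it, so that each vertex has
  the same out-degrees as one that is created by stage `K + 1` and occurs in the terminal part of
  stage `2 * K + 1`;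
* a vertex `v` of stage `n` is the source of infinitely many `a`-labelled arcs if and only if the
  target of such an arc is created after stage `n + K`, since the ancestors of that arc then repeat
  a type, which can be pumped; in that case a target of this kind shows up by stage
  `n + 3 * K + 1`, and otherwise all `a`-labelled arcs from `v` are present at that stage.

With `n = 2 * K + 1`, simulating a single derivation up to stage `5 * K + 2` therefore decides the
condition.
-/

/-! ### Isomorphisms of hypergraphs -/

theorem injOn_list_map {α β : Type*} {f : α → β} {s : Set α} (hf : Set.InjOn f s) :
    Set.InjOn (List.map f) {l | ∀ x ∈ l, x ∈ s} := by
  intro l hl l' hl' h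
  induction l generalizing l' with
  | nil => exact (List.map_eq_nil_iff.1 h.symm).symm
  | cons x l ih =>
    obtain ⟨y, k, rfl, hy, hk⟩ := List.map_eq_cons_iff.1 h.symm
    obtain ⟨hx, hl⟩ := List.forall_mem_cons.1 hl
    obtain ⟨hy', hk'⟩ := List.forall_mem_cons.1 hl'
    rw [hf hx hy' hy.symm, ih hl hk' hk.symm]

theorem exists_eqOn_of_monotone {α β : Type*} {s : ℕ → Set α} (hs : Monotone s)
    {F : ℕ → α → β} (hF : ∀ n, Set.EqOn (F (n + 1)) (F n) (s n)) :
    ∃ Φ : α → β, ∀ n, Set.EqOn Φ (F n) (s n) := by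
  have hle : ∀ {m n}, m ≤ n → Set.EqOn (F n) (F m) (s m) := by
    intro m n hmn
    induction n, hmn using Nat.le_induction with
    | base => exact Set.eqOn_refl _ _
    | succ n hmn ih => exact ((hF n).mono (hs hmn)).trans ih
  refine ⟨fun v => F (sInf {n | v ∈ s n}) v, fun n v hv => ?_⟩
  have hmem : v ∈ s (sInf {n | v ∈ s n}) := Nat.sInf_mem (s := {n | v ∈ s n}) ⟨n, hv⟩
  exact (hle (Nat.sInf_le hv) hmem).symm

namespace Hyperarc

theorem mapVertices_congr {f g : ℕ → ℕ} {X : Hyperarc} (h : ∀ v ∈ X.2, f v = g v) :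
    X.mapVertices f = X.mapVertices g :=
  Prod.ext rfl (List.map_congr_left h)

theorem mapVertices_mapVertices (f g : ℕ → ℕ) (X : Hyperarc) :
    (X.mapVertices f).mapVertices g = X.mapVertices (g ∘ f) := by
  simp [mapVertices]

theorem mem_mapVertices {f : ℕ → ℕ} {X : Hyperarc} {v : ℕ} :
    v ∈ (X.mapVertices f).2 ↔ ∃ u ∈ X.2, f u = v :=
  List.mem_map

end Hyperarc

theorem hyperVertices_mono {H H' : Set Hyperarc} (h : H ⊆ H') :
    hyperVertices H ⊆ hyperVertices H' :=
  fun _ ⟨X, hX, hv⟩ => ⟨X, h hX, hv⟩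

theorem hyperVertices_singleton (X : Hyperarc) : hyperVertices {X} = {v | v ∈ X.2} := by
  ext v; simp [hyperVertices]

theorem hyperVertices_iUnion {ι : Sort*} (M : ι → Set Hyperarc) :
    hyperVertices (⋃ i, M i) = ⋃ i, hyperVertices (M i) := by
  ext v
  simp only [hyperVertices, Set.mem_iUnion, Set.mem_ofPred_eq]
  exact ⟨fun ⟨X, ⟨i, hX⟩, hv⟩ => ⟨i, X, hX, hv⟩, fun ⟨i, X, hX, hv⟩ => ⟨X, ⟨i, hX⟩, hv⟩⟩

theorem hyperVertices_image (f : ℕ → ℕ) (H : Set Hyperarc) :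
    hyperVertices (Hyperarc.mapVertices f '' H) = f '' hyperVertices H := by
  ext v
  constructor
  · rintro ⟨_, ⟨X, hX, rfl⟩, hv⟩
    obtain ⟨u, hu, rfl⟩ := Hyperarc.mem_mapVertices.1 hv
    exact ⟨u, ⟨X, hX, hu⟩, rfl⟩
  · rintro ⟨u, ⟨X, hX, hu⟩, rfl⟩
    exact ⟨_, ⟨X, hX, rfl⟩, Hyperarc.mem_mapVertices.2 ⟨u, hu, rfl⟩⟩

theorem finite_hyperVertices {H : Set Hyperarc} (hH : H.Finite) : (hyperVertices H).Finite := by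
  refine (hH.biUnion fun X _ => X.2.finite_toSet).subset fun v ⟨X, hX, hv⟩ => ?_
  exact Set.mem_biUnion hX hv

theorem terminalPart_subset (H : Set Hyperarc) : terminalPart H ⊆ H := fun _ h => h.1

theorem terminalPart_image (f : ℕ → ℕ) (H : Set Hyperarc) :
    terminalPart (Hyperarc.mapVertices f '' H) = Hyperarc.mapVertices f '' terminalPart H := by
  ext Y
  constructor
  · rintro ⟨⟨X, hX, rfl⟩, h⟩
    exact ⟨X, ⟨hX, h⟩, rfl⟩
  · rintro ⟨X, ⟨hX, h⟩, rfl⟩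
    exact ⟨⟨X, hX, rfl⟩, h⟩

theorem arcTargets_subset_hyperVertices (H : Set Hyperarc) (v a : ℕ) :
    arcTargets H v a ⊆ hyperVertices H := fun _ h => ⟨_, h, by simp⟩

theorem arcTargets_mono {H H' : Set Hyperarc} (h : H ⊆ H') (v a : ℕ) :
    arcTargets H v a ⊆ arcTargets H' v a :=
  fun _ hv' => h hv'

theorem arcTargets_terminalPart (H : Set Hyperarc) (v a : ℕ) :
    arcTargets (terminalPart H) v a = arcTargets H v a :=
  Set.ext fun _ => ⟨fun h => h.1, fun h => ⟨h, fun _ => HRSymbol.noConfusion⟩⟩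

theorem arcTargets_image {f : ℕ → ℕ} {H : Set Hyperarc} (hf : Set.InjOn f (hyperVertices H))
    {v : ℕ} (hv : v ∈ hyperVertices H) (a : ℕ) :
    arcTargets (Hyperarc.mapVertices f '' H) (f v) a = f '' arcTargets H v a := by
  ext u
  constructor
  · rintro ⟨⟨s, l⟩, hX, h⟩
    obtain ⟨rfl, hl⟩ := Prod.mk.inj h
    obtain ⟨x, _, rfl, hx, hl⟩ := List.map_eq_cons_iff.1 hl
    obtain ⟨y, rfl, rfl⟩ := List.map_eq_singleton_iff.1 hl
    obtain rfl : x = v := hf ⟨_, hX, by simp⟩ hv hx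
    exact ⟨y, hX, rfl⟩
  · rintro ⟨y, hy, rfl⟩
    exact ⟨_, hy, rfl⟩

/-- The map `f` of vertices is an isomorphism from the hypergraph `H` onto `H'`. Only the values
of `f` on the vertices of `H` matter. -/
structure IsIsoOn (f : ℕ → ℕ) (H H' : Set Hyperarc) : Prop where
  injOn : Set.InjOn f (hyperVertices H)
  image_eq : Hyperarc.mapVertices f '' H = H'

namespace IsIsoOn

variable {f : ℕ → ℕ} {H H' : Set Hyperarc}

theorem hyperVertices_eq (hf : IsIsoOn f H H') : hyperVertices H' = f '' hyperVertices H := by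
  rw [← hf.image_eq, hyperVertices_image]

theorem mapVertices_mem (hf : IsIsoOn f H H') {X : Hyperarc} (hX : X ∈ H) :
    X.mapVertices f ∈ H' :=
  hf.image_eq ▸ Set.mem_image_of_mem _ hX

theorem mem_hyperVertices (hf : IsIsoOn f H H') {v : ℕ} (hv : v ∈ hyperVertices H) :
    f v ∈ hyperVertices H' :=
  hf.hyperVertices_eq ▸ Set.mem_image_of_mem f hv

theorem congr (hf : IsIsoOn f H H') {g : ℕ → ℕ} (hg : Set.EqOn g f (hyperVertices H)) :
    IsIsoOn g H H' where
  injOn := hf.injOn.congr hg.symm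
  image_eq := by
    rw [← hf.image_eq]
    exact Set.image_congr fun X hX => Hyperarc.mapVertices_congr fun v hv => hg ⟨X, hX, hv⟩

theorem singleton {X : Hyperarc} (hf : Set.InjOn f {v | v ∈ X.2}) :
    IsIsoOn f {X} {X.mapVertices f} where
  injOn := by rwa [hyperVertices_singleton]
  image_eq := Set.image_singleton

theorem terminalPart (hf : IsIsoOn f H H') : IsIsoOn f (terminalPart H) (terminalPart H') where
  injOn := hf.injOn.mono (hyperVertices_mono (terminalPart_subset H))
  image_eq := by rw [← hf.image_eq, terminalPart_image]

theorem arcTargets_eq (hf : IsIsoOn f H H') {v : ℕ} (hv : v ∈ hyperVertices H) (a : ℕ) :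
    arcTargets H' (f v) a = f '' arcTargets H v a := by
  rw [← hf.image_eq, arcTargets_image hf.injOn hv]

theorem encard_arcTargets_eq (hf : IsIsoOn f H H') {v : ℕ} (hv : v ∈ hyperVertices H) (a : ℕ) :
    (arcTargets H' (f v) a).encard = (arcTargets H v a).encard := by
  rw [hf.arcTargets_eq hv,
    (hf.injOn.mono (arcTargets_subset_hyperVertices H v a)).encard_image]

theorem iUnion {M M' : ℕ → Set Hyperarc} (hM : Monotone fun n => hyperVertices (M n))
    (hf : ∀ n, IsIsoOn f (M n) (M' n)) : IsIsoOn f (⋃ n, M n) (⋃ n, M' n) where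
  injOn := by
    rw [hyperVertices_iUnion]
    exact Set.inj_on_iUnion_of_directed hM.directed_le fun n => (hf n).injOn
  image_eq := by simp only [Set.image_iUnion, (hf _).image_eq]

end IsIsoOn

/-! ### Complete parallel rewriting -/

namespace HRGrammar

variable {G : HRGrammar}

/-- The result of replacing each non-terminal hyperarc `A vs` of `S` along the map `h A vs`. -/
def rewrite (G : HRGrammar) (h : ℕ → List ℕ → ℕ → ℕ) (S : Set Hyperarc) : Set Hyperarc :=
  terminalPart S ∪
    {Y | ∃ A vs, (HRSymbol.nonterminal A, vs) ∈ S ∧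
      ∃ X ∈ G.rhs A, Y = Hyperarc.mapVertices (h A vs) X}

/-- The maps `h A vs` define a complete parallel rewriting of `S`. -/
structure IsRewriting (G : HRGrammar) (h : ℕ → List ℕ → ℕ → ℕ) (S : Set Hyperarc) : Prop where
  repl : ∀ A vs, (HRSymbol.nonterminal A, vs) ∈ S → G.IsReplacement S A vs (h A vs)
  disj : ∀ A vs B ws, (HRSymbol.nonterminal A, vs) ∈ S → (HRSymbol.nonterminal B, ws) ∈ S →
    (A, vs) ≠ (B, ws) →
    Disjoint (h A vs '' G.innerVertices A) (h B ws '' G.innerVertices B)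

theorem parallelRewrites_iff {M M' : Set Hyperarc} :
    G.ParallelRewrites M M' ↔ ∃ h, G.IsRewriting h M ∧ M' = G.rewrite h M :=
  ⟨fun ⟨h, h1, h2, h3⟩ => ⟨h, ⟨h1, h2⟩, h3⟩, fun ⟨h, h1, h2⟩ => ⟨h, h1.repl, h1.disj, h2⟩⟩

/-- The vertices that a rewriting of `S` creates, before they are embedded into `ℕ`: the triple
`(A, vs, w)` stands for the copy of the inner vertex `w` of `H_A` made for the hyperarc `A vs`. -/
def newVertices (G : HRGrammar) (S : Set Hyperarc) : Set (ℕ × List ℕ × ℕ) :=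
  {t | (HRSymbol.nonterminal t.1, t.2.1) ∈ S ∧ t.2.2 ∈ G.innerVertices t.1}

section Rewriting

variable {h h' : ℕ → List ℕ → ℕ → ℕ} {S S' : Set Hyperarc} {φ ψ : ℕ → ℕ}

theorem rewrite_mono (h : ℕ → List ℕ → ℕ → ℕ) (hS : S ⊆ S') : G.rewrite h S ⊆ G.rewrite h S' := by
  rintro Y (hY | ⟨A, vs, hA, hX⟩)
  · exact Or.inl ⟨hS hY.1, hY.2⟩
  · exact Or.inr ⟨A, vs, hS hA, hX⟩

theorem mem_rewrite_iff {Y : Hyperarc} : Y ∈ G.rewrite h S ↔ ∃ X ∈ S, Y ∈ G.rewrite h {X} := by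
  constructor
  · rintro (hY | ⟨A, vs, hA, hX⟩)
    · exact ⟨Y, hY.1, Or.inl ⟨rfl, hY.2⟩⟩
    · exact ⟨_, hA, Or.inr ⟨A, vs, rfl, hX⟩⟩
  · rintro ⟨X, hX, hY⟩
    exact rewrite_mono h (Set.singleton_subset_iff.2 hX) hY

theorem IsReplacement.anti {A : ℕ} {vs : List ℕ} {g : ℕ → ℕ} (H : G.IsReplacement S' A vs g)
    (hS : S ⊆ S') : G.IsReplacement S A vs g :=
  ⟨H.map_inputs, H.injOn, fun w hw hv => H.fresh w hw (hyperVertices_mono hS hv)⟩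

theorem IsReplacement.mem_of_mem_inputs {A : ℕ} {vs : List ℕ} {g : ℕ → ℕ}
    (H : G.IsReplacement S A vs g) {w : ℕ} (hw : w ∈ G.inputs A) : g w ∈ vs :=
  H.map_inputs ▸ List.mem_map_of_mem hw

theorem IsHyperarc.mapVertices {X : Hyperarc} (hX : G.IsHyperarc X) (f : ℕ → ℕ) :
    G.IsHyperarc (X.mapVertices f) := by
  obtain ⟨_ | _ | _, l⟩ := X <;> simpa [IsHyperarc, Hyperarc.mapVertices] using hX

theorem IsHyperarc.rewrite (hG : G.IsValid) (hS : ∀ X ∈ S, G.IsHyperarc X) :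
    ∀ Y ∈ G.rewrite h S, G.IsHyperarc Y := by
  rintro Y (hY | ⟨A, vs, hA, X, hX, rfl⟩)
  · exact hS _ hY.1
  · exact (hG.rhs_isHyperarc A (hS _ hA).1 X hX).mapVertices _

theorem map_newVertices_mem (hφ : IsIsoOn φ S S') {t : ℕ × List ℕ × ℕ}
    (ht : t ∈ G.newVertices S) : (t.1, t.2.1.map φ, t.2.2) ∈ G.newVertices S' :=
  ⟨hφ.mapVertices_mem ht.1, ht.2⟩

theorem injOn_map_newVertices (hφ : Set.InjOn φ (hyperVertices S)) :
    Set.InjOn (fun t : ℕ × List ℕ × ℕ => (t.1, t.2.1.map φ, t.2.2)) (G.newVertices S) := by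
  rintro ⟨A, vs, w⟩ ⟨hA, -⟩ ⟨B, us, u⟩ ⟨hB, -⟩ e
  simp only [Prod.mk.injEq] at e ⊢
  exact ⟨e.1, injOn_list_map hφ (fun v hv => ⟨_, hA, hv⟩) (fun v hv => ⟨_, hB, hv⟩) e.2.1, e.2.2⟩

namespace IsRewriting

theorem anti (H : G.IsRewriting h S') (hS : S ⊆ S') : G.IsRewriting h S :=
  ⟨fun A vs hA => (H.repl A vs (hS hA)).anti hS,
    fun A vs B ws hA hB => H.disj A vs B ws (hS hA) (hS hB)⟩

theorem injOn_newVertices (H : G.IsRewriting h S) :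
    Set.InjOn (fun t : ℕ × List ℕ × ℕ => h t.1 t.2.1 t.2.2) (G.newVertices S) := by
  rintro ⟨A, vs, w⟩ ⟨hA, hw⟩ ⟨B, us, u⟩ ⟨hB, hu⟩ e
  by_cases hne : (A, vs) = (B, us)
  · obtain ⟨rfl, rfl⟩ := Prod.mk.inj hne
    obtain rfl : w = u := (H.repl A vs hA).injOn hw hu e
    rfl
  · exact absurd e ((H.disj A vs B us hA hB hne).ne_of_mem
      (Set.mem_image_of_mem _ hw) (Set.mem_image_of_mem _ hu))

theorem disjoint_newVertices (H : G.IsRewriting h S) :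
    Disjoint (hyperVertices S)
      ((fun t : ℕ × List ℕ × ℕ => h t.1 t.2.1 t.2.2) '' G.newVertices S) := by
  rw [Set.disjoint_right]
  rintro _ ⟨t, ht, rfl⟩
  exact (H.repl t.1 t.2.1 ht.1).fresh t.2.2 ht.2

theorem hyperVertices_rewrite_subset (H : G.IsRewriting h S) :
    hyperVertices (G.rewrite h S) ⊆ hyperVertices S ∪
      (fun t : ℕ × List ℕ × ℕ => h t.1 t.2.1 t.2.2) '' G.newVertices S := by
  rintro v ⟨Y, hY | ⟨A, vs, hA, X, hX, rfl⟩, hv⟩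
  · exact Or.inl ⟨Y, hY.1, hv⟩
  · obtain ⟨w, hw, rfl⟩ := Hyperarc.mem_mapVertices.1 hv
    by_cases hi : w ∈ G.inputs A
    · exact Or.inl ⟨_, hA, (H.repl A vs hA).mem_of_mem_inputs hi⟩
    · exact Or.inr ⟨(A, vs, w), ⟨hA, ⟨X, hX, hw⟩, hi⟩, rfl⟩

theorem hyperVertices_subset_rewrite (hG : G.IsValid) (hS : ∀ X ∈ S, G.IsHyperarc X)
    (H : G.IsRewriting h S) : hyperVertices S ⊆ hyperVertices (G.rewrite h S) := by
  rintro v ⟨⟨s, l⟩, hX, hv⟩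
  by_cases hs : ∃ A, s = HRSymbol.nonterminal A
  · obtain ⟨A, rfl⟩ := hs
    obtain ⟨w, hw, rfl⟩ : ∃ w ∈ G.inputs A, h A l w = v := by
      rwa [← List.mem_map, (H.repl A l hX).map_inputs]
    obtain ⟨Y, hY, hwY⟩ := hG.inputs_mem A (hS _ hX).1 w hw
    exact ⟨_, Or.inr ⟨A, l, hX, Y, hY, rfl⟩, Hyperarc.mem_mapVertices.2 ⟨w, hwY, rfl⟩⟩
  · exact ⟨_, Or.inl ⟨hX, fun A hA => hs ⟨A, hA⟩⟩, hv⟩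

theorem exists_eqOn_newVertices (H : G.IsRewriting h S) (φ : ℕ → ℕ) (g : ℕ × List ℕ × ℕ → ℕ) :
    ∃ ψ : ℕ → ℕ, Set.EqOn ψ φ (hyperVertices S) ∧
      ∀ t ∈ G.newVertices S, ψ (h t.1 t.2.1 t.2.2) = g t := by
  classical
  refine ⟨(hyperVertices S).piecewise φ
    (g ∘ Function.invFunOn (fun t => h t.1 t.2.1 t.2.2) (G.newVertices S)),
    Set.piecewise_eqOn _ _ _, fun t ht => ?_⟩
  rw [Set.piecewise_eq_of_notMem _ _ _ ((H.repl t.1 t.2.1 ht.1).fresh t.2.2 ht.2)]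
  exact congrArg g (H.injOn_newVertices.leftInvOn_invFunOn ht)

theorem injOn_rewrite (H : G.IsRewriting h S) (H' : G.IsRewriting h' S') (hφ : IsIsoOn φ S S')
    (hold : Set.EqOn ψ φ (hyperVertices S))
    (hnew : ∀ t ∈ G.newVertices S, ψ (h t.1 t.2.1 t.2.2) = h' t.1 (t.2.1.map φ) t.2.2) :
    Set.InjOn ψ (hyperVertices (G.rewrite h S)) := by
  refine Set.InjOn.mono H.hyperVertices_rewrite_subset
    ((Set.injOn_union H.disjoint_newVertices).2 ⟨hφ.injOn.congr hold.symm, ?_, ?_⟩)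
  · refine Set.InjOn.image_of_comp (Set.InjOn.congr ?_ fun t ht => (hnew t ht).symm)
    exact H'.injOn_newVertices.comp (injOn_map_newVertices hφ.injOn)
      fun t ht => map_newVertices_mem hφ ht
  · rintro v hv _ ⟨t, ht, rfl⟩
    rw [hold hv, hnew t ht]
    exact H'.disjoint_newVertices.ne_of_mem (hφ.mem_hyperVertices hv)
      ⟨_, map_newVertices_mem hφ ht, rfl⟩

theorem eqOn_comp_rhs (H : G.IsRewriting h S) (H' : G.IsRewriting h' S') (hφ : IsIsoOn φ S S')
    (hold : Set.EqOn ψ φ (hyperVertices S))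
    (hnew : ∀ t ∈ G.newVertices S, ψ (h t.1 t.2.1 t.2.2) = h' t.1 (t.2.1.map φ) t.2.2)
    {A : ℕ} {vs : List ℕ} (hA : (HRSymbol.nonterminal A, vs) ∈ S) :
    Set.EqOn (ψ ∘ h A vs) (h' A (vs.map φ)) (hyperVertices (G.rhs A)) := by
  intro w hw
  by_cases hi : w ∈ G.inputs A
  · have hmap : (G.inputs A).map (φ ∘ h A vs) = (G.inputs A).map (h' A (vs.map φ)) := by
      rw [← List.map_map, (H.repl A vs hA).map_inputs,
        (H'.repl A _ (hφ.mapVertices_mem hA)).map_inputs]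
    rw [← List.map_inj_left.1 hmap w hi]
    exact hold ⟨_, hA, (H.repl A vs hA).mem_of_mem_inputs hi⟩
  · exact hnew (A, vs, w) ⟨hA, hw, hi⟩

end IsRewriting

theorem image_rewrite (hold : Set.EqOn ψ φ (hyperVertices S))
    (hrhs : ∀ A vs, (HRSymbol.nonterminal A, vs) ∈ S →
      Set.EqOn (ψ ∘ h A vs) (h' A (vs.map φ)) (hyperVertices (G.rhs A))) :
    Hyperarc.mapVertices ψ '' G.rewrite h S = G.rewrite h' (Hyperarc.mapVertices φ '' S) := by
  have hterm : ∀ X ∈ S, X.mapVertices ψ = X.mapVertices φ := fun X hX =>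
    Hyperarc.mapVertices_congr fun v hv => hold ⟨X, hX, hv⟩
  have hcopy : ∀ A vs, (HRSymbol.nonterminal A, vs) ∈ S → ∀ X ∈ G.rhs A,
      (X.mapVertices (h A vs)).mapVertices ψ = X.mapVertices (h' A (vs.map φ)) := by
    intro A vs hA X hX
    rw [Hyperarc.mapVertices_mapVertices]
    exact Hyperarc.mapVertices_congr fun w hw => hrhs A vs hA ⟨X, hX, hw⟩
  rw [rewrite, rewrite, Set.image_union, terminalPart_image]
  congr 1
  · exact Set.image_congr fun X hX => hterm X hX.1
  · ext Y
    constructor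
    · rintro ⟨_, ⟨A, vs, hA, X, hX, rfl⟩, rfl⟩
      exact ⟨A, vs.map φ, ⟨_, hA, rfl⟩, X, hX, hcopy A vs hA X hX⟩
    · rintro ⟨A, _, ⟨⟨_, vs⟩, hA, hAe⟩, X, hX, rfl⟩
      obtain ⟨rfl, rfl⟩ := Prod.mk.inj hAe
      exact ⟨_, ⟨A, vs, hA, X, hX, rfl⟩, hcopy A vs hA X hX⟩

theorem IsRewriting.exists_isIsoOn_rewrite (H : G.IsRewriting h S) (H' : G.IsRewriting h' S')
    (hφ : IsIsoOn φ S S') :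
    ∃ ψ : ℕ → ℕ, Set.EqOn ψ φ (hyperVertices S) ∧
      IsIsoOn ψ (G.rewrite h S) (G.rewrite h' S') := by
  obtain ⟨ψ, hold, hnew⟩ :=
    H.exists_eqOn_newVertices φ fun t => h' t.1 (t.2.1.map φ) t.2.2
  refine ⟨ψ, hold, H.injOn_rewrite H' hφ hold hnew, ?_⟩
  rw [image_rewrite hold fun A vs hA => H.eqOn_comp_rhs H' hφ hold hnew hA, hφ.image_eq]

end Rewriting

end HRGrammar

/-! ### Derivations -/

namespace HRGrammar

variable {G : HRGrammar} {M M' : ℕ → Set Hyperarc} {h h' : ℕ → ℕ → List ℕ → ℕ → ℕ}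

/-- The grammar `G` is valid, and `M` is an infinite sequence of complete parallel rewritings of
hypergraphs over `G`, the rewriting of `M n` being defined by the maps `h n A vs`. The initial
hypergraph is arbitrary, so that the descendants of a single hyperarc form a derivation as well. -/
structure IsDerivation (G : HRGrammar) (M : ℕ → Set Hyperarc) (h : ℕ → ℕ → List ℕ → ℕ → ℕ) :
    Prop where
  valid : G.IsValid
  isHyperarc_zero : ∀ X ∈ M 0, G.IsHyperarc X
  isRewriting : ∀ n, G.IsRewriting (h n) (M n)
  succ : ∀ n, M (n + 1) = G.rewrite (h n) (M n)

/-- The graph generated along the derivation `M`. -/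
def limitGraph (M : ℕ → Set Hyperarc) : Set Hyperarc := ⋃ n, terminalPart (M n)

/-- What becomes of the set `S` of hyperarcs present at time `n` after `t` rewritings. -/
def descendants (G : HRGrammar) (h : ℕ → ℕ → List ℕ → ℕ → ℕ) (n : ℕ) (S : Set Hyperarc) :
    ℕ → Set Hyperarc
  | 0 => S
  | t + 1 => G.rewrite (h (n + t)) (descendants G h n S t)

/-- `Z 0, …, Z t` is a line of descent starting at time `n`: the hyperarc `Z i` exists at time
`n + i`, and `Z (i + 1)` is one of the hyperarcs that it is rewritten to. -/
def IsLineage (G : HRGrammar) (h : ℕ → ℕ → List ℕ → ℕ → ℕ) (n t : ℕ) (Z : ℕ → Hyperarc) : Prop :=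
  ∀ i < t, Z (i + 1) ∈ G.rewrite (h (n + i)) {Z i}

theorem descendants_mono (h : ℕ → ℕ → List ℕ → ℕ → ℕ) (n : ℕ) {S S' : Set Hyperarc}
    (hS : S ⊆ S') (t : ℕ) : G.descendants h n S t ⊆ G.descendants h n S' t := by
  induction t with
  | zero => exact hS
  | succ t ih => exact rewrite_mono _ ih

theorem exists_isLineage {n t : ℕ} {S : Set Hyperarc} {Y : Hyperarc}
    (hY : Y ∈ G.descendants h n S t) : ∃ Z, G.IsLineage h n t Z ∧ Z 0 ∈ S ∧ Z t = Y := by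
  induction t generalizing Y with
  | zero => exact ⟨fun _ => Y, fun i hi => absurd hi i.not_lt_zero, hY, rfl⟩
  | succ t ih =>
    obtain ⟨W, hW, hYW⟩ := mem_rewrite_iff.1 hY
    obtain ⟨Z, hZ, hZ0, rfl⟩ := ih hW
    refine ⟨Function.update Z (t + 1) Y, fun i hi => ?_, ?_, Function.update_self ..⟩
    · rw [Function.update_of_ne (by lia : i ≠ t + 1)]
      obtain hit | rfl := Nat.lt_succ_iff_lt_or_eq.1 hi
      · rw [Function.update_of_ne (by lia : i + 1 ≠ t + 1)]
        exact hZ i hit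
      · rwa [Function.update_self]
    · rwa [Function.update_of_ne (by lia : 0 ≠ t + 1)]

theorem IsLineage.mem_descendants {n t : ℕ} {Z : ℕ → Hyperarc} (hZ : G.IsLineage h n t Z)
    {i j : ℕ} (hij : i ≤ j) (hj : j ≤ t) : Z j ∈ G.descendants h (n + i) {Z i} (j - i) := by
  induction j, hij using Nat.le_induction with
  | base => simp [descendants]
  | succ j hij ih =>
    rw [Nat.sub_add_comm hij, descendants, Nat.add_assoc, Nat.add_sub_cancel' hij, mem_rewrite_iff]
    exact ⟨Z j, ih (by lia), hZ j hj⟩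

namespace IsDerivation

theorem isHyperarc (D : G.IsDerivation M h) (n : ℕ) : ∀ X ∈ M n, G.IsHyperarc X := by
  induction n with
  | zero => exact D.isHyperarc_zero
  | succ n ih => rw [D.succ]; exact IsHyperarc.rewrite D.valid ih

theorem descendants_eq (D : G.IsDerivation M h) (n t : ℕ) :
    G.descendants h n (M n) t = M (n + t) := by
  induction t with
  | zero => rfl
  | succ t ih => rw [HRGrammar.descendants, ih, ← Nat.add_assoc, D.succ]

theorem descendants_subset (D : G.IsDerivation M h) {n : ℕ} {S : Set Hyperarc}
    (hS : S ⊆ M n) (t : ℕ) : G.descendants h n S t ⊆ M (n + t) :=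
  D.descendants_eq n t ▸ descendants_mono h n hS t

theorem descendants (D : G.IsDerivation M h) {n : ℕ} {S : Set Hyperarc} (hS : S ⊆ M n) :
    G.IsDerivation (G.descendants h n S) (fun t => h (n + t)) where
  valid := D.valid
  isHyperarc_zero X hX := D.isHyperarc n X (hS hX)
  isRewriting t := (D.isRewriting (n + t)).anti (D.descendants_subset hS t)
  succ _ := rfl

theorem monotone_hyperVertices (D : G.IsDerivation M h) :
    Monotone fun n => hyperVertices (M n) := by
  refine monotone_nat_of_le_succ fun n => ?_
  rw [D.succ]
  exact (D.isRewriting n).hyperVertices_subset_rewrite D.valid (D.isHyperarc n)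

theorem monotone_terminalPart (D : G.IsDerivation M h) : Monotone fun n => terminalPart (M n) := by
  refine monotone_nat_of_le_succ fun n X hX => ?_
  rw [D.succ]
  exact ⟨Or.inl hX, hX.2⟩

theorem exists_ancestor (D : G.IsDerivation M h) {n t : ℕ} {Y : Hyperarc} (hY : Y ∈ M (n + t)) :
    ∃ X ∈ M n, Y ∈ G.descendants h n {X} t := by
  rw [← D.descendants_eq] at hY
  obtain ⟨Z, hZ, hZ0, rfl⟩ := exists_isLineage hY
  exact ⟨Z 0, hZ0, hZ.mem_descendants t.zero_le le_rfl⟩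

theorem isLineage_mem (D : G.IsDerivation M h) {n t : ℕ} {Z : ℕ → Hyperarc}
    (hZ : G.IsLineage h n t Z) (hZ0 : Z 0 ∈ M n) {i : ℕ} (hi : i ≤ t) : Z i ∈ M (n + i) :=
  D.descendants_subset (Set.singleton_subset_iff.2 hZ0) i (hZ.mem_descendants i.zero_le hi)

theorem notMem_hyperVertices_of_notMem (D : G.IsDerivation M h) {n : ℕ}
    {S : Set Hyperarc} (hS : S ⊆ M n) {t v : ℕ}
    (hv : v ∈ hyperVertices (G.descendants h n S t)) (hvS : v ∉ hyperVertices S) :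
    v ∉ hyperVertices (M n) := by
  induction t with
  | zero => exact absurd hv hvS
  | succ t ih =>
    obtain hv | ⟨s, ⟨hA, hw⟩, rfl⟩ :=
      ((D.descendants hS).isRewriting t).hyperVertices_rewrite_subset hv
    · exact ih hv
    · exact fun hm => ((D.isRewriting (n + t)).repl _ _ (D.descendants_subset hS t hA)).fresh _ hw
        (D.monotone_hyperVertices (Nat.le_add_right n t) hm)

theorem mem_of_mem_descendants (D : G.IsDerivation M h) {n t v : ℕ} {X Y : Hyperarc}
    (hX : X ∈ M n) (hY : Y ∈ G.descendants h n {X} t) (hvY : v ∈ Y.2)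
    (hv : v ∈ hyperVertices (M n)) : v ∈ X.2 := by
  by_contra hvX
  exact D.notMem_hyperVertices_of_notMem (Set.singleton_subset_iff.2 hX) ⟨Y, hY, hvY⟩
    (by rwa [hyperVertices_singleton]) hv

theorem exists_isIsoOn (D : G.IsDerivation M h) (D' : G.IsDerivation M' h') {φ : ℕ → ℕ}
    (hφ : IsIsoOn φ (M 0) (M' 0)) :
    ∃ Φ : ℕ → ℕ, Set.EqOn Φ φ (hyperVertices (M 0)) ∧ ∀ t, IsIsoOn Φ (M t) (M' t) := by
  have hstep : ∀ t (f : {f // IsIsoOn f (M t) (M' t)}),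
      ∃ g : {g // IsIsoOn g (M (t + 1)) (M' (t + 1))}, Set.EqOn g.1 f.1 (hyperVertices (M t)) := by
    rintro t ⟨f, hf⟩
    obtain ⟨g, hgf, hg⟩ := (D.isRewriting t).exists_isIsoOn_rewrite (D'.isRewriting t) hf
    rw [← D.succ, ← D'.succ] at hg
    exact ⟨⟨g, hg⟩, hgf⟩
  choose next hnext using hstep
  let F : ∀ t, {f // IsIsoOn f (M t) (M' t)} := Nat.rec ⟨φ, hφ⟩ next
  obtain ⟨Φ, hΦ⟩ := exists_eqOn_of_monotone D.monotone_hyperVertices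
    (F := fun t => (F t).1) fun t => hnext t (F t)
  exact ⟨Φ, hΦ 0, fun t => (F t).2.congr (hΦ t)⟩

theorem isIsoOn_limitGraph (D : G.IsDerivation M h) {Φ : ℕ → ℕ}
    (hΦ : ∀ t, IsIsoOn Φ (M t) (M' t)) : IsIsoOn Φ (limitGraph M) (limitGraph M') :=
  IsIsoOn.iUnion (fun _ _ hmn => hyperVertices_mono (D.monotone_terminalPart hmn))
    fun t => (hΦ t).terminalPart

end IsDerivation

end HRGrammar

/-! ### Types of hyperarcs -/

/-- Each entry of the list is replaced by the position of its first occurrence, so that two lists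
have the same pattern if they have the same length and the same equalities between entries. -/
def equalityPattern {α : Type*} [DecidableEq α] (l : List α) : List ℕ := l.map l.idxOf

section EqualityPattern

variable {α β : Type*} [DecidableEq α] [DecidableEq β]

theorem length_equalityPattern (l : List α) : (equalityPattern l).length = l.length :=
  List.length_map _

theorem getElem_equalityPattern (l : List α) {i : ℕ} (hi : i < (equalityPattern l).length) :
    (equalityPattern l)[i] = l.idxOf (l[i]'(length_equalityPattern l ▸ hi)) :=
  List.getElem_map _

theorem lt_length_of_mem_equalityPattern {l : List α} {i : ℕ} (hi : i ∈ equalityPattern l) :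
    i < l.length := by
  obtain ⟨x, hx, rfl⟩ := List.mem_map.1 hi
  exact List.idxOf_lt_length_of_mem hx

theorem idxOf_map_of_injOn {l : List α} {f : α → β} (hf : Set.InjOn f {x | x ∈ l}) {x : α}
    (hx : x ∈ l) : (l.map f).idxOf (f x) = l.idxOf x := by
  induction l with
  | nil => rfl
  | cons y l ih =>
    by_cases hyx : y = x
    · subst hyx; simp
    · have hne : f y ≠ f x := fun e => hyx (hf List.mem_cons_self hx e)
      rw [List.map_cons, List.idxOf_cons_ne _ hne, List.idxOf_cons_ne _ hyx,
        ih (hf.mono fun _ => List.mem_cons_of_mem y)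
          ((List.mem_cons.1 hx).resolve_left (Ne.symm hyx))]

theorem equalityPattern_map {l : List α} {f : α → β} (hf : Set.InjOn f {x | x ∈ l}) :
    equalityPattern (l.map f) = equalityPattern l := by
  rw [equalityPattern, List.map_map]
  exact List.map_congr_left fun x hx => idxOf_map_of_injOn hf hx

theorem nodup_iff_equalityPattern_eq {l : List α} :
    l.Nodup ↔ equalityPattern l = List.range l.length := by
  refine ⟨fun hl => List.ext_getElem (by simp [length_equalityPattern]) fun i hi _ => ?_,
    fun h => List.Nodup.of_map l.idxOf (h ▸ List.nodup_range : (equalityPattern l).Nodup)⟩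
  rw [getElem_equalityPattern, hl.idxOf_getElem, List.getElem_range]

theorem exists_injOn_map_eq [Inhabited β] {l : List α} {l' : List β}
    (h : equalityPattern l = equalityPattern l') :
    ∃ f : α → β, Set.InjOn f {x | x ∈ l} ∧ l.map f = l' := by
  have hlen : l.length = l'.length := by
    rw [← length_equalityPattern l, h, length_equalityPattern]
  have hidx : ∀ i (hi : i < l.length), l.idxOf l[i] = l'.idxOf (l'[i]'(hlen ▸ hi)) := by
    intro i hi
    rw [← getElem_equalityPattern l (by rwa [length_equalityPattern]),
      ← getElem_equalityPattern l' (by rwa [length_equalityPattern, ← hlen])]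
    simp only [h]
  have hf : ∀ i (hi : i < l.length), l'.getD (l.idxOf l[i]) default = l'[i]'(hlen ▸ hi) := by
    intro i hi
    rw [hidx i hi, List.getD_eq_getElem _ _ (List.idxOf_lt_length_of_mem (List.getElem_mem _)),
      List.getElem_idxOf]
  refine ⟨fun x => l'.getD (l.idxOf x) default, fun x hx y hy e => ?_,
    List.ext_getElem (by simpa using hlen) fun i hi _ => ?_⟩
  · obtain ⟨i, hi, rfl⟩ := List.mem_iff_getElem.1 hx
    obtain ⟨j, hj, rfl⟩ := List.mem_iff_getElem.1 hy
    simp only [hf] at e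
    exact (List.idxOf_inj hx).1 (by rw [hidx i hi, hidx j hj, e])
  · rw [List.getElem_map]
    exact hf i (by simpa using hi)

end EqualityPattern

/-- The isomorphism type of the hyperarc `X` relative to the distinguished vertices `us`. -/
def hyperarcType (us : List ℕ) (X : Hyperarc) : HRSymbol × List ℕ :=
  (X.1, equalityPattern (X.2 ++ us))

theorem exists_mapVertices_eq_of_hyperarcType_eq {us : List ℕ} {X Y : Hyperarc}
    (h : hyperarcType us X = hyperarcType us Y) :
    ∃ φ : ℕ → ℕ, Set.InjOn φ {v | v ∈ X.2} ∧ X.mapVertices φ = Y ∧ ∀ u ∈ us, φ u = u := by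
  obtain ⟨hlabel, hpattern⟩ := Prod.mk.inj h
  obtain ⟨φ, hφ, hmap⟩ := exists_injOn_map_eq hpattern
  have hlen := congrArg List.length hpattern
  simp only [length_equalityPattern, List.length_append, Nat.add_right_cancel_iff] at hlen
  rw [List.map_append] at hmap
  obtain ⟨hX, hus⟩ := List.append_inj hmap (by simpa using hlen)
  exact ⟨φ, hφ.mono fun v => List.mem_append_left us, Prod.ext hlabel hX,
    List.map_inj_left.1 (hus.trans us.map_id.symm)⟩

theorem hyperarcType_mapVertices {us : List ℕ} {X : Hyperarc} {φ : ℕ → ℕ}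
    (hφ : Set.InjOn φ {v | v ∈ X.2 ++ us}) (hus : ∀ u ∈ us, φ u = u) :
    hyperarcType us (X.mapVertices φ) = hyperarcType us X := by
  have hmap : us.map φ = us := (List.map_congr_left hus).trans us.map_id
  have happ : X.2.map φ ++ us = (X.2 ++ us).map φ := by rw [List.map_append, hmap]
  exact Prod.ext rfl ((congrArg equalityPattern happ).trans (equalityPattern_map hφ))

theorem mem_of_hyperarcType_eq {us : List ℕ} {X Y : Hyperarc}
    (h : hyperarcType us X = hyperarcType us Y) {u : ℕ} (hu : u ∈ us) (huX : u ∈ X.2) :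
    u ∈ Y.2 := by
  obtain ⟨φ, -, rfl, hus⟩ := exists_mapVertices_eq_of_hyperarcType_eq h
  exact Hyperarc.mem_mapVertices.2 ⟨u, huX, hus u hu⟩

theorem eq_of_hyperarcType_eq {us : List ℕ} {X Y : Hyperarc}
    (h : hyperarcType us X = hyperarcType us Y) (hX : ∀ v ∈ X.2, v ∈ us) : X = Y := by
  obtain ⟨φ, -, rfl, hus⟩ := exists_mapVertices_eq_of_hyperarcType_eq h
  have hid : X.mapVertices φ = X.mapVertices id :=
    Hyperarc.mapVertices_congr fun v hv => hus v (hX v hv)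
  rw [hid, Hyperarc.mapVertices, List.map_id]

namespace HRGrammar

variable {G : HRGrammar}

/-- An upper bound for the number of vertices of a hyperarc over `G`. -/
def lengthBound (G : HRGrammar) : ℕ := 2 + (G.rules.map fun r => r.2.length).sum

/-- The number of symbols of `G`. -/
def symbolCount (G : HRGrammar) : ℕ := G.rules.length + G.arcLabels + G.colours

/-- The position of a symbol in the list of all non-terminals, arc labels and colours of `G`. -/
def symbolNumber (G : HRGrammar) : HRSymbol → ℕ
  | HRSymbol.nonterminal A => A
  | HRSymbol.arcLabel a => G.rules.length + a
  | HRSymbol.colour c => G.rules.length + G.arcLabels + c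

/-- An upper bound for the number of types that the hyperarcs over `G` have relative to at most two
distinguished vertices. It is the pumping constant of the decision procedure. -/
def typeBound (G : HRGrammar) : ℕ :=
  G.symbolCount * (G.lengthBound + 2) ^ (G.lengthBound + 2)

namespace IsHyperarc

variable {X Y : Hyperarc}

theorem symbolNumber_lt (hX : G.IsHyperarc X) : G.symbolNumber X.1 < G.symbolCount := by
  obtain ⟨_ | _ | _, _⟩ := X <;> simp only [IsHyperarc] at hX <;>
    simp only [symbolNumber, symbolCount] <;> lia

theorem symbolNumber_inj (hX : G.IsHyperarc X) (hY : G.IsHyperarc Y)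
    (h : G.symbolNumber X.1 = G.symbolNumber Y.1) : X.1 = Y.1 := by
  obtain ⟨_ | _ | _, _⟩ := X <;> obtain ⟨_ | _ | _, _⟩ := Y <;> simp only [IsHyperarc] at hX hY <;>
    simp only [symbolNumber] at h <;> grind

theorem length_eq (hX : G.IsHyperarc X) (hY : G.IsHyperarc Y) (h : X.1 = Y.1) :
    X.2.length = Y.2.length := by
  obtain ⟨_ | _ | _, _⟩ := X <;> obtain ⟨_, _⟩ := Y <;> obtain rfl := h <;>
    exact hX.2.trans hY.2.symm

end IsHyperarc

theorem arity_le_sum (G : HRGrammar) (A : ℕ) :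
    G.arity A ≤ (G.rules.map fun r => r.2.length).sum := by
  rw [arity, inputs]
  by_cases hA : A < G.rules.length
  · rw [List.getD_eq_getElem _ _ hA]
    exact List.single_le_sum (fun _ _ => Nat.zero_le _) _
      (List.mem_map.2 ⟨_, List.getElem_mem hA, rfl⟩)
  · rw [List.getD_eq_default _ _ (not_lt.1 hA)]
    exact Nat.zero_le _

theorem IsHyperarc.length_le {X : Hyperarc} (hX : G.IsHyperarc X) :
    X.2.length ≤ G.lengthBound := by
  obtain ⟨A | _ | _, _⟩ := X <;> simp only [IsHyperarc] at hX <;> rw [lengthBound, hX.2]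
  · exact le_add_left (G.arity_le_sum A)
  · exact Nat.le_add_right 2 _
  · lia

/-- The type of a hyperarc over `G` relative to at most two vertices, as an element of a finite
type with `G.typeBound` elements. The pattern is padded with zeros. -/
def typeCode (us : List ℕ) (hus : us.length ≤ 2) {X : Hyperarc} (hX : G.IsHyperarc X) :
    Fin G.symbolCount × (Fin (G.lengthBound + 2) → Fin (G.lengthBound + 2)) :=
  (⟨G.symbolNumber X.1, hX.symbolNumber_lt⟩, fun i =>
    ⟨(hyperarcType us X).2.getD i 0, by
      have hlen : (X.2 ++ us).length ≤ G.lengthBound + 2 := by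
        rw [List.length_append]; exact add_le_add hX.length_le hus
      rcases lt_or_ge (i : ℕ) (hyperarcType us X).2.length with hi | hi
      · rw [List.getD_eq_getElem _ _ hi]
        exact (lt_length_of_mem_equalityPattern (List.getElem_mem hi)).trans_le hlen
      · rw [List.getD_eq_default _ _ hi]
        exact Nat.succ_pos _⟩)

theorem hyperarcType_eq_of_typeCode_eq {us : List ℕ} {hus : us.length ≤ 2} {X Y : Hyperarc}
    {hX : G.IsHyperarc X} {hY : G.IsHyperarc Y}
    (h : G.typeCode us hus hX = G.typeCode us hus hY) :
    hyperarcType us X = hyperarcType us Y := by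
  simp only [typeCode, Prod.mk.injEq, Fin.mk.injEq] at h
  have hlabel := hX.symbolNumber_inj hY h.1
  have hlen := hX.length_eq hY hlabel
  refine Prod.ext hlabel (List.ext_getElem ?_ fun i hiX hiY => ?_)
  · simp [hyperarcType, length_equalityPattern, hlen]
  · have hi : i < G.lengthBound + 2 := by
      refine hiX.trans_le ?_
      rw [hyperarcType, length_equalityPattern, List.length_append]
      exact add_le_add hX.length_le hus
    have hcode := Fin.mk.inj (congrFun h.2 ⟨i, hi⟩)
    rwa [List.getD_eq_getElem _ _ hiX, List.getD_eq_getElem _ _ hiY] at hcode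

theorem exists_lt_hyperarcType_eq {us : List ℕ} (hus : us.length ≤ 2) {Z : ℕ → Hyperarc}
    (hZ : ∀ i ≤ G.typeBound, G.IsHyperarc (Z i)) :
    ∃ i j, i < j ∧ j ≤ G.typeBound ∧ hyperarcType us (Z i) = hyperarcType us (Z j) := by
  obtain ⟨i, j, hne, hcode⟩ := Fintype.exists_ne_map_eq_of_card_lt
    (fun i : Fin (G.typeBound + 1) => G.typeCode us hus (hZ i (Nat.le_of_lt_succ i.2)))
    (by
      simp only [Fintype.card_prod, Fintype.card_fun, Fintype.card_fin]
      exact Nat.lt_succ_self _)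
  have htype := hyperarcType_eq_of_typeCode_eq hcode
  rcases lt_or_gt_of_ne hne with hlt | hlt
  · exact ⟨i, j, hlt, Nat.le_of_lt_succ j.2, htype⟩
  · exact ⟨j, i, hlt, Nat.le_of_lt_succ i.2, htype.symm⟩

end HRGrammar

/-! ### Pumping -/

namespace HRGrammar

variable {G : HRGrammar} {M : ℕ → Set Hyperarc} {h : ℕ → ℕ → List ℕ → ℕ → ℕ}

theorem terminalPart_subset_limitGraph (M : ℕ → Set Hyperarc) (n : ℕ) :
    terminalPart (M n) ⊆ limitGraph M :=
  Set.subset_iUnion (fun n => terminalPart (M n)) n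

theorem arcTargets_subset_limitGraph (M : ℕ → Set Hyperarc) (n v a : ℕ) :
    arcTargets (M n) v a ⊆ arcTargets (limitGraph M) v a := by
  rw [← arcTargets_terminalPart (M n)]
  exact arcTargets_mono (terminalPart_subset_limitGraph M n) v a

theorem exists_mem_hyperVertices {v : ℕ} (hv : v ∈ hyperVertices (limitGraph M)) :
    ∃ n, v ∈ hyperVertices (M n) := by
  rw [limitGraph, hyperVertices_iUnion, Set.mem_iUnion] at hv
  exact hv.imp fun n hn => hyperVertices_mono (terminalPart_subset (M n)) hn

theorem exists_first_mem_hyperVertices {n v : ℕ} (hv : v ∈ hyperVertices (limitGraph M))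
    (hM : Monotone fun n => hyperVertices (M n)) (hn : v ∉ hyperVertices (M n)) :
    ∃ r, v ∉ hyperVertices (M (n + r)) ∧ v ∈ hyperVertices (M (n + (r + 1))) := by
  obtain ⟨t, ht⟩ := exists_mem_hyperVertices hv
  exact Nat.exists_not_and_succ_of_not_zero_of_exists
    (p := fun r => v ∈ hyperVertices (M (n + r))) hn ⟨t, hM (Nat.le_add_left t n) ht⟩

theorem mem_descendants_trans {n s t : ℕ} {S : Set Hyperarc} {X Y : Hyperarc}
    (hX : X ∈ G.descendants h n S s) (hY : Y ∈ G.descendants h (n + s) {X} t) :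
    Y ∈ G.descendants h n S (s + t) := by
  induction t generalizing Y with
  | zero => obtain rfl := hY; exact hX
  | succ t ih =>
    obtain ⟨W, hW, hYW⟩ := mem_rewrite_iff.1 hY
    rw [Nat.add_assoc] at hYW
    exact mem_rewrite_iff.2 ⟨W, ih hW, hYW⟩

theorem IsRewriting.eq_of_mem_hyperVertices_rewrite {g : ℕ → List ℕ → ℕ → ℕ} {S : Set Hyperarc}
    (H : G.IsRewriting g S) {X X' : Hyperarc} (hX : X ∈ S) (hX' : X' ∈ S) {v : ℕ}
    (hv : v ∈ hyperVertices (G.rewrite g {X})) (hv' : v ∈ hyperVertices (G.rewrite g {X'}))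
    (hvS : v ∉ hyperVertices S) : X = X' := by
  have hnew : ∀ {X}, X ∈ S → v ∈ hyperVertices (G.rewrite g {X}) →
      ∃ t ∈ G.newVertices S, (HRSymbol.nonterminal t.1, t.2.1) = X ∧ g t.1 t.2.1 t.2.2 = v := by
    intro X hX hv
    have hXS := Set.singleton_subset_iff.2 hX
    obtain hv | ⟨t, ⟨htX, ht⟩, htv⟩ := (H.anti hXS).hyperVertices_rewrite_subset hv
    · exact absurd (hyperVertices_mono hXS hv) hvS
    · exact ⟨t, ⟨hXS htX, ht⟩, htX, htv⟩
  obtain ⟨t, ht, rfl, htv⟩ := hnew hX hv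
  obtain ⟨t', ht', rfl, htv'⟩ := hnew hX' hv'
  rw [H.injOn_newVertices ht ht' (htv.trans htv'.symm)]

namespace IsDerivation

theorem exists_isLineage_of_mem_limitGraph (D : G.IsDerivation M h) {Y : Hyperarc}
    (hY : Y ∈ limitGraph M) (n N : ℕ) :
    ∃ t ≥ N, ∃ Z, G.IsLineage h n t Z ∧ Z 0 ∈ M n ∧ Z t = Y := by
  obtain ⟨r, hr⟩ := Set.mem_iUnion.1 hY
  have hYM : Y ∈ M (n + (N + r)) := (D.monotone_terminalPart (by lia) hr).1
  rw [← D.descendants_eq] at hYM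
  exact ⟨N + r, Nat.le_add_right N r, exists_isLineage hYM⟩

theorem mem_of_isLineage (D : G.IsDerivation M h) {n t : ℕ} {Z : ℕ → Hyperarc}
    (hZ : G.IsLineage h n t Z) (hZ0 : Z 0 ∈ M n) {i v : ℕ} (hi : i ≤ t)
    (hv : v ∈ hyperVertices (M (n + i))) (hvt : v ∈ (Z t).2) : v ∈ (Z i).2 :=
  D.mem_of_mem_descendants (D.isLineage_mem hZ hZ0 hi) (hZ.mem_descendants hi le_rfl) hvt hv

theorem exists_isIsoOn_descendants (D : G.IsDerivation M h) {us : List ℕ} {m n : ℕ}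
    {X X' : Hyperarc} (hX : X ∈ M m) (hX' : X' ∈ M n)
    (htype : hyperarcType us X = hyperarcType us X') (hus : ∀ u ∈ us, u ∈ X.2) :
    ∃ Φ : ℕ → ℕ, (∀ u ∈ us, Φ u = u) ∧
      ∀ t, IsIsoOn Φ (G.descendants h m {X} t) (G.descendants h n {X'} t) := by
  obtain ⟨φ, hφ, rfl, hfix⟩ := exists_mapVertices_eq_of_hyperarcType_eq htype
  obtain ⟨Φ, hΦφ, hΦ⟩ := (D.descendants (Set.singleton_subset_iff.2 hX)).exists_isIsoOn
    (D.descendants (Set.singleton_subset_iff.2 hX')) (IsIsoOn.singleton hφ)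
  exact ⟨Φ, fun u hu => (hΦφ ⟨X, rfl, hus u hu⟩).trans (hfix u hu), hΦ⟩

theorem notMem_hyperVertices_of_isIsoOn (D : G.IsDerivation M h) {m n t v : ℕ} {X X' : Hyperarc}
    {Φ : ℕ → ℕ} (hX : X ∈ M m) (hX' : X' ∈ M n)
    (hΦ : ∀ t, IsIsoOn Φ (G.descendants h m {X} t) (G.descendants h n {X'} t))
    (hv : v ∈ hyperVertices (G.descendants h m {X} t)) (hvX : v ∉ X.2) :
    Φ v ∉ hyperVertices (M n) := by
  refine D.notMem_hyperVertices_of_notMem (Set.singleton_subset_iff.2 hX')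
    ((hΦ t).mem_hyperVertices hv) fun hv' => hvX ?_
  obtain ⟨u, hu, huv⟩ : Φ v ∈ Φ '' hyperVertices {X} := (hΦ 0).hyperVertices_eq ▸ hv'
  have hut := (D.descendants (Set.singleton_subset_iff.2 hX)).monotone_hyperVertices t.zero_le hu
  rw [hyperVertices_singleton] at hu
  exact (hΦ t).injOn hut hv huv ▸ hu

theorem exists_descendant_hyperarcType_eq (D : G.IsDerivation M h) {us : List ℕ} {m n t : ℕ}
    {X X' Y : Hyperarc} (hX : X ∈ M m) (hX' : X' ∈ M n)
    (htype : hyperarcType us X = hyperarcType us X') (hus : ∀ u ∈ us, u ∈ X.2)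
    (hY : Y ∈ G.descendants h m {X} t) :
    ∃ Y' ∈ G.descendants h n {X'} t, hyperarcType us Y = hyperarcType us Y' := by
  obtain ⟨Φ, hfix, hΦ⟩ := D.exists_isIsoOn_descendants hX hX' htype hus
  refine ⟨_, (hΦ t).mapVertices_mem hY,
    (hyperarcType_mapVertices ((hΦ t).injOn.mono fun v hv => ?_) hfix).symm⟩
  rcases List.mem_append.1 hv with hv | hv
  · exact ⟨Y, hY, hv⟩
  · exact (D.descendants (Set.singleton_subset_iff.2 hX)).monotone_hyperVertices t.zero_le
      ⟨X, rfl, hus v hv⟩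

theorem exists_le_typeBound_hyperarcType_eq (D : G.IsDerivation M h) {us : List ℕ}
    (hlen : us.length ≤ 2) {n t : ℕ} {X Y : Hyperarc} (hX : X ∈ M n) (hus : ∀ u ∈ us, u ∈ X.2)
    (hY : Y ∈ G.descendants h n {X} t) (husY : ∀ u ∈ us, u ∈ Y.2) :
    ∃ s ≤ G.typeBound, ∃ Y' ∈ G.descendants h n {X} s, hyperarcType us Y = hyperarcType us Y' := by
  -- In a shortest line of descent to a hyperarc of this type, no type is repeated: the part between
  -- two hyperarcs of equal type could be cut out.
  classical
  have hex : ∃ s, ∃ Y' ∈ G.descendants h n {X} s, hyperarcType us Y = hyperarcType us Y' :=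
    ⟨t, Y, hY, rfl⟩
  refine ⟨Nat.find hex, ?_, Nat.find_spec hex⟩
  by_contra! hlt
  obtain ⟨Y', hY', hYY'⟩ := Nat.find_spec hex
  obtain ⟨Z, hZ, rfl, rfl⟩ := exists_isLineage hY'
  have hZM : ∀ i ≤ Nat.find hex, Z i ∈ M (n + i) := fun i => D.isLineage_mem hZ hX
  obtain ⟨i, j, hij, hj, htype⟩ :=
    exists_lt_hyperarcType_eq hlen fun i hi => D.isHyperarc _ _ (hZM i (hi.trans hlt.le))
  have husj : ∀ u ∈ us, u ∈ (Z j).2 := fun u hu =>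
    D.mem_of_isLineage hZ hX (by lia)
      (D.monotone_hyperVertices (Nat.le_add_right n j) ⟨_, hX, hus u hu⟩)
      (mem_of_hyperarcType_eq hYY' hu (husY u hu))
  obtain ⟨W, hW, hYW⟩ := D.exists_descendant_hyperarcType_eq (hZM j (by lia))
    (hZM i (by lia)) htype.symm husj (hZ.mem_descendants (by lia) le_rfl)
  refine Nat.find_min hex ?_ ⟨W, mem_descendants_trans ?_ hW, hYY'.trans hYW⟩
  · lia
  · simpa using hZ.mem_descendants i.zero_le (by lia)

theorem exists_ge_hyperarcType_eq (D : G.IsDerivation M h) {us : List ℕ} {m t : ℕ}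
    {X Y : Hyperarc} (hX : X ∈ M m) (hus : ∀ u ∈ us, u ∈ X.2) (ht : 0 < t)
    (hY : Y ∈ G.descendants h m {X} t) (htype : hyperarcType us X = hyperarcType us Y) (r : ℕ) :
    ∃ m' ≥ r, ∃ W ∈ M m', hyperarcType us X = hyperarcType us W := by
  induction r with
  | zero => exact ⟨m, m.zero_le, X, hX, rfl⟩
  | succ r ih =>
    obtain ⟨m', hm', W, hW, hXW⟩ := ih
    obtain ⟨W', hW', hYW'⟩ := D.exists_descendant_hyperarcType_eq hX hW hXW hus hY
    exact ⟨m' + t, by lia, W', D.descendants_subset (Set.singleton_subset_iff.2 hW) t hW',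
      htype.trans hYW'⟩

theorem exists_terminal_hyperarcType_eq (D : G.IsDerivation M h) {us : List ℕ}
    (hlen : us.length ≤ 2) {n : ℕ} (hus : ∀ u ∈ us, u ∈ hyperVertices (M n)) {Y : Hyperarc}
    (hY : Y ∈ limitGraph M) (husY : ∀ u ∈ us, u ∈ Y.2) :
    ∃ Y' ∈ terminalPart (M (n + G.typeBound)), hyperarcType us Y = hyperarcType us Y' := by
  obtain ⟨t, -, Z, hZ, hZ0, rfl⟩ := D.exists_isLineage_of_mem_limitGraph hY n 0
  obtain ⟨s, hs, Y', hY', htype⟩ := D.exists_le_typeBound_hyperarcType_eq hlen hZ0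
    (fun u hu => D.mem_of_isLineage hZ hZ0 t.zero_le (hus u hu) (husY u hu))
    (hZ.mem_descendants t.zero_le le_rfl) husY
  have hterm : ∀ A, Y'.1 ≠ HRSymbol.nonterminal A := by
    obtain ⟨r, hr⟩ := Set.mem_iUnion.1 hY
    exact fun A => (Prod.mk.inj htype).1 ▸ hr.2 A
  exact ⟨Y', D.monotone_terminalPart (Nat.add_le_add_left hs n)
    ⟨D.descendants_subset (Set.singleton_subset_iff.2 hZ0) s hY', hterm⟩, htype⟩

theorem mem_hyperVertices_terminalPart (D : G.IsDerivation M h) {n v : ℕ}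
    (hv : v ∈ hyperVertices (M n)) (hvH : v ∈ hyperVertices (limitGraph M)) :
    v ∈ hyperVertices (terminalPart (M (n + G.typeBound))) := by
  obtain ⟨Y, hY, hvY⟩ := hvH
  obtain ⟨Y', hY', htype⟩ := D.exists_terminal_hyperarcType_eq (us := [v]) (by simp)
    (by simpa) hY (by simpa)
  exact ⟨Y', hY', mem_of_hyperarcType_eq htype (by simp) hvY⟩

theorem mem_arcTargets_add_typeBound (D : G.IsDerivation M h) {n v v' a : ℕ}
    (hv : v ∈ hyperVertices (M n)) (hv' : v' ∈ hyperVertices (M n))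
    (ha : v' ∈ arcTargets (limitGraph M) v a) : v' ∈ arcTargets (M (n + G.typeBound)) v a := by
  obtain ⟨Y', hY', htype⟩ := D.exists_terminal_hyperarcType_eq (us := [v, v']) (n := n) (by simp)
    (by simp [hv, hv']) ha (by simp)
  rw [← eq_of_hyperarcType_eq htype (by simp)] at hY'
  exact hY'.1

theorem monotone_arcTargets (D : G.IsDerivation M h) (v a : ℕ) :
    Monotone fun n => arcTargets (M n) v a := fun m n hmn => by
  simp only [← arcTargets_terminalPart (M _)]
  exact arcTargets_mono (D.monotone_terminalPart hmn) v a

theorem exists_arcTarget_of_hyperarcType_eq (D : G.IsDerivation M h) {m n t v v' a : ℕ}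
    {X X' : Hyperarc} (hX : X ∈ M m) (hX' : X' ∈ M n)
    (htype : hyperarcType [v] X = hyperarcType [v] X') (hv : v ∈ X.2) (hv' : v' ∉ X.2)
    (ha : v' ∈ arcTargets (G.descendants h m {X} t) v a) :
    ∃ u ∈ arcTargets (limitGraph M) v a, u ∉ hyperVertices (M n) ∧
      ∀ s, v' ∈ hyperVertices (G.descendants h m {X} s) → u ∈ hyperVertices (M (n + s)) := by
  obtain ⟨Φ, hfix, hΦ⟩ := D.exists_isIsoOn_descendants hX hX' htype (by simpa)
  have hsub := D.descendants_subset (Set.singleton_subset_iff.2 hX')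
  have hmem : Φ v' ∈ arcTargets (G.descendants h n {X'} t) v a := by
    have himage := Set.mem_image_of_mem Φ ha
    rwa [← (hΦ t).arcTargets_eq ⟨_, ha, by simp⟩, hfix v (by simp)] at himage
  exact ⟨Φ v', arcTargets_subset_limitGraph M (n + t) v a (arcTargets_mono (hsub t) v a hmem),
    D.notMem_hyperVertices_of_isIsoOn hX hX' hΦ
      (arcTargets_subset_hyperVertices _ v a ha) hv',
    fun s hs => hyperVertices_mono (hsub s) ((hΦ s).mem_hyperVertices hs)⟩

theorem exists_subset_hyperVertices_of_finite (D : G.IsDerivation M h) {S : Set ℕ}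
    (hfin : S.Finite) (hS : S ⊆ hyperVertices (limitGraph M)) : ∃ n, S ⊆ hyperVertices (M n) := by
  choose! r hr using fun u hu => exists_mem_hyperVertices (hS (a := u) hu)
  exact ⟨hfin.toFinset.sup r, fun u hu =>
    D.monotone_hyperVertices (Finset.le_sup (hfin.mem_toFinset.2 hu)) (hr u hu)⟩

theorem arcTargets_subset_hyperVertices_of_finite (D : G.IsDerivation M h) {n v a : ℕ}
    (hv : v ∈ hyperVertices (M n)) (hfin : (arcTargets (limitGraph M) v a).Finite) :
    arcTargets (limitGraph M) v a ⊆ hyperVertices (M (n + G.typeBound)) := by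
  -- The ancestors of an arc to a target `v'` that is created late contain two hyperarcs of the same
  -- type relative to `v`; pumping the part between them creates new targets arbitrarily late.
  intro v' ha
  by_contra hlate
  obtain ⟨t, ht, Z, hZ, hZ0, hZt⟩ := D.exists_isLineage_of_mem_limitGraph ha n G.typeBound
  have hZM : ∀ i ≤ t, Z i ∈ M (n + i) := fun i => D.isLineage_mem hZ hZ0
  obtain ⟨i, j, hij, hj, htype⟩ := exists_lt_hyperarcType_eq (us := [v]) (by simp)
    fun i hi => D.isHyperarc _ _ (hZM i (hi.trans ht))
  have hvZ : v ∈ (Z i).2 := D.mem_of_isLineage hZ hZ0 (by lia)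
    (D.monotone_hyperVertices (Nat.le_add_right n i) hv) (by simp [hZt])
  have hv'Z : v' ∉ (Z i).2 := fun hv' =>
    hlate (D.monotone_hyperVertices (by lia) ⟨_, hZM i (by lia), hv'⟩)
  have hYZ : (HRSymbol.arcLabel a, [v, v']) ∈ G.descendants h (n + i) {Z i} (t - i) :=
    hZt ▸ hZ.mem_descendants (by lia) le_rfl
  obtain ⟨r, hr⟩ := D.exists_subset_hyperVertices_of_finite hfin
    (arcTargets_subset_hyperVertices _ v a)
  obtain ⟨m, hm, W, hW, hZW⟩ := D.exists_ge_hyperarcType_eq (hZM i (by lia)) (by simpa)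
    (Nat.sub_pos_of_lt hij) (hZ.mem_descendants hij.le (hj.trans ht)) htype r
  obtain ⟨u, hu, huM, -⟩ :=
    D.exists_arcTarget_of_hyperarcType_eq (hZM i (by lia)) hW hZW hvZ hv'Z hYZ
  exact huM (D.monotone_hyperVertices hm (hr hu))

theorem arcTargets_limitGraph_subset (D : G.IsDerivation M h) {n v a : ℕ}
    (hv : v ∈ hyperVertices (M n))
    (hearly : arcTargets (M (n + 2 * G.typeBound + 1)) v a ⊆ hyperVertices (M n)) :
    arcTargets (limitGraph M) v a ⊆ hyperVertices (M n) := by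
  -- A target `v'` created by the rewriting of a hyperarc `Z r` has a counterpart `u`, created by
  -- the rewriting of a hyperarc of the same type that appears within `K` steps; the arc from `v` to
  -- `u` appears within another `K` steps.
  intro v' ha
  by_contra hn
  obtain ⟨r, hr0, hr1⟩ := exists_first_mem_hyperVertices
    (arcTargets_subset_hyperVertices _ v a ha) D.monotone_hyperVertices hn
  obtain ⟨t, ht, Z, hZ, hZ0, hZt⟩ := D.exists_isLineage_of_mem_limitGraph ha n (r + 1)
  have hZM : ∀ i ≤ t, Z i ∈ M (n + i) := fun i => D.isLineage_mem hZ hZ0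
  have hvZ : ∀ i ≤ t, v ∈ (Z i).2 := fun i hi => D.mem_of_isLineage hZ hZ0 hi
    (D.monotone_hyperVertices (Nat.le_add_right n i) hv) (by simp [hZt])
  have hv'Z : v' ∈ (Z (r + 1)).2 := D.mem_of_isLineage hZ hZ0 ht hr1 (by simp [hZt])
  have hZr : Z r ∈ G.descendants h n {Z 0} r := hZ.mem_descendants r.zero_le (by lia)
  obtain ⟨s, hs, W, hW, hZW⟩ := D.exists_le_typeBound_hyperarcType_eq (us := [v]) (by simp) hZ0
    (by simpa using hvZ 0 t.zero_le) hZr (by simpa using hvZ r (by lia))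
  have hWM := D.descendants_subset (Set.singleton_subset_iff.2 hZ0) s hW
  have hYZ : (HRSymbol.arcLabel a, [v, v']) ∈ G.descendants h (n + r) {Z r} (t - r) :=
    hZt ▸ hZ.mem_descendants (by lia) le_rfl
  obtain ⟨u, hu, huM, hus⟩ := D.exists_arcTarget_of_hyperarcType_eq (hZM r (by lia)) hWM hZW
    (hvZ r (by lia)) (fun hv' => hr0 ⟨_, hZM r (by lia), hv'⟩) hYZ
  have hu1 : u ∈ hyperVertices (M (n + s + 1)) := hus 1 ⟨_, hZ r (by lia), hv'Z⟩
  have hu2 := D.mem_arcTargets_add_typeBound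
    (D.monotone_hyperVertices (by lia : n ≤ n + s + 1) hv) hu1 hu
  exact huM (D.monotone_hyperVertices (Nat.le_add_right n s)
    (hearly (D.monotone_arcTargets v a (by lia) hu2)))

theorem arcTargets_limitGraph_eq (D : G.IsDerivation M h) {n N v a : ℕ}
    (hv : v ∈ hyperVertices (M n)) (hn : arcTargets (limitGraph M) v a ⊆ hyperVertices (M n))
    (hN : n + G.typeBound ≤ N) : arcTargets (limitGraph M) v a = arcTargets (M N) v a :=
  Set.Subset.antisymm
    (fun _ hu => D.monotone_arcTargets v a hN (D.mem_arcTargets_add_typeBound hv (hn hu) hu))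
    (arcTargets_subset_limitGraph M N v a)

theorem finite_arcTargets_limitGraph_iff (D : G.IsDerivation M h) (hfin : ∀ n, (M n).Finite)
    {n v a : ℕ} (hv : v ∈ hyperVertices (M n)) :
    (arcTargets (limitGraph M) v a).Finite ↔
      arcTargets (M (n + 3 * G.typeBound + 1)) v a ⊆ hyperVertices (M (n + G.typeBound)) := by
  refine ⟨fun hf => (arcTargets_subset_limitGraph M _ v a).trans
    (D.arcTargets_subset_hyperVertices_of_finite hv hf), fun hsub => ?_⟩
  refine Set.Finite.subset (finite_hyperVertices (hfin (n + G.typeBound)))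
    (D.arcTargets_limitGraph_subset
      (D.monotone_hyperVertices (Nat.le_add_right n G.typeBound) hv) ?_)
  rwa [show n + G.typeBound + 2 * G.typeBound + 1 = n + 3 * G.typeBound + 1 by lia]

end IsDerivation

end HRGrammar

/-! ### The condition at a vertex -/

section HasUnitWeightAt

variable {k : ℕ} {μ : Fin k → ℝ}

/-- The condition of a probabilistic grammar at a vertex `v` of the graph `H`. -/
def HasUnitWeightAt (μ : Fin k → ℝ) (H : Set Hyperarc) (v : ℕ) : Prop :=
  (∀ a : Fin k, (arcTargets H v a).Finite) ∧
    ∑ a : Fin k, μ a * ((arcTargets H v a).ncard : ℝ) = 1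

theorem hasUnitWeightAt_congr {H H' : Set Hyperarc} {v v' : ℕ}
    (hvv' : ∀ a, (arcTargets H v a).encard = (arcTargets H' v' a).encard) :
    HasUnitWeightAt μ H v ↔ HasUnitWeightAt μ H' v' := by
  simp only [HasUnitWeightAt, ← Set.encard_ne_top_iff, Set.ncard, hvv']

theorem IsIsoOn.hasUnitWeightAt_iff {H H' : Set Hyperarc} {f : ℕ → ℕ} (hf : IsIsoOn f H H') :
    (∀ v ∈ hyperVertices H', HasUnitWeightAt μ H' v) ↔
      ∀ v ∈ hyperVertices H, HasUnitWeightAt μ H v := by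
  rw [hf.hyperVertices_eq, Set.forall_mem_image]
  exact forall₂_congr fun v hv => hasUnitWeightAt_congr (hf.encard_arcTargets_eq hv)

end HasUnitWeightAt

namespace HRGrammar

variable {G : HRGrammar} {M : ℕ → Set Hyperarc} {h : ℕ → ℕ → List ℕ → ℕ → ℕ}

namespace IsDerivation

theorem limitGraph_descendants_subset (D : G.IsDerivation M h) {n : ℕ} {S : Set Hyperarc}
    (hS : S ⊆ M n) : limitGraph (G.descendants h n S) ⊆ limitGraph M :=
  Set.iUnion_subset fun t _ hX =>
    terminalPart_subset_limitGraph M (n + t) ⟨D.descendants_subset hS t hX.1, hX.2⟩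

theorem mem_limitGraph_descendants (D : G.IsDerivation M h) {n v : ℕ} {X Y : Hyperarc}
    (hX : X ∈ M n) (hv : v ∈ hyperVertices (G.rewrite (h n) {X})) (hvM : v ∉ hyperVertices (M n))
    (hY : Y ∈ limitGraph M) (hvY : v ∈ Y.2) : Y ∈ limitGraph (G.descendants h n {X}) := by
  obtain ⟨t, ht, Z, hZ, hZ0, rfl⟩ := D.exists_isLineage_of_mem_limitGraph hY n 1
  have hvM1 : v ∈ hyperVertices (M (n + 1)) :=
    hyperVertices_mono (D.descendants_subset (Set.singleton_subset_iff.2 hX) 1) hv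
  have hv1 : v ∈ (Z 1).2 := D.mem_of_isLineage hZ hZ0 ht hvM1 hvY
  obtain rfl : X = Z 0 := (D.isRewriting n).eq_of_mem_hyperVertices_rewrite hX hZ0 hv
    ⟨Z 1, hZ 0 ht, hv1⟩ hvM
  obtain ⟨r, hr⟩ := Set.mem_iUnion.1 hY
  exact terminalPart_subset_limitGraph _ t ⟨hZ.mem_descendants t.zero_le le_rfl, hr.2⟩

theorem arcTargets_limitGraph_descendants (D : G.IsDerivation M h) {n v : ℕ} {X : Hyperarc}
    (hX : X ∈ M n) (hv : v ∈ hyperVertices (G.rewrite (h n) {X})) (hvM : v ∉ hyperVertices (M n))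
    (a : ℕ) : arcTargets (limitGraph (G.descendants h n {X})) v a = arcTargets (limitGraph M) v a :=
  Set.Subset.antisymm
    (arcTargets_mono (D.limitGraph_descendants_subset (Set.singleton_subset_iff.2 hX)) v a)
    fun _ hu => D.mem_limitGraph_descendants hX hv hvM hu (by simp)

theorem exists_early_vertex (D : G.IsDerivation M h) (hM : hyperVertices (M 0) = ∅) {v : ℕ}
    (hv : v ∈ hyperVertices (limitGraph M)) :
    ∃ v' ∈ hyperVertices (terminalPart (M (2 * G.typeBound + 1))), ∀ a,
      (arcTargets (limitGraph M) v' a).encard = (arcTargets (limitGraph M) v a).encard := by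
  -- All arcs at `v` descend from the hyperarc `X` whose rewriting creates `v`, and a hyperarc of
  -- the same type as `X` appears within `K` steps.
  obtain ⟨n, hvn, Y, hY, hvY⟩ := exists_first_mem_hyperVertices (n := 0) hv
    D.monotone_hyperVertices (hM ▸ Set.notMem_empty v)
  rw [Nat.zero_add] at hvn hY
  obtain ⟨X, hX, hYX⟩ := D.exists_ancestor hY
  have hvX : v ∈ hyperVertices (G.rewrite (h n) {X}) := ⟨Y, hYX, hvY⟩
  obtain ⟨X₀, hX₀, hXX₀⟩ := D.exists_ancestor (n := 0) (by rwa [Nat.zero_add])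
  obtain ⟨s, hs, X', hX', htype⟩ := D.exists_le_typeBound_hyperarcType_eq (us := []) (by simp) hX₀
    (by simp) hXX₀ (by simp)
  have hX'M : X' ∈ M s := by
    simpa using D.descendants_subset (Set.singleton_subset_iff.2 hX₀) s hX'
  obtain ⟨Φ, -, hΦ⟩ := D.exists_isIsoOn_descendants hX hX'M htype (by simp)
  have hlim := (D.descendants (Set.singleton_subset_iff.2 hX)).isIsoOn_limitGraph hΦ
  have hv' : Φ v ∈ hyperVertices (G.rewrite (h s) {X'}) := (hΦ 1).mem_hyperVertices hvX
  have hv's : Φ v ∉ hyperVertices (M s) :=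
    D.notMem_hyperVertices_of_isIsoOn (t := 1) hX hX'M hΦ hvX fun hmem => hvn ⟨X, hX, hmem⟩
  have hvlim : v ∈ hyperVertices (limitGraph (G.descendants h n {X})) := by
    obtain ⟨W, hW, hvW⟩ := hv
    exact ⟨W, D.mem_limitGraph_descendants hX hvX hvn hW hvW, hvW⟩
  refine ⟨Φ v, ?_, fun a => ?_⟩
  · refine hyperVertices_mono (D.monotone_terminalPart (by lia))
      (D.mem_hyperVertices_terminalPart (n := s + 1) ?_ ?_)
    · exact hyperVertices_mono (D.descendants_subset (Set.singleton_subset_iff.2 hX'M) 1) hv'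
    · exact hyperVertices_mono (D.limitGraph_descendants_subset (Set.singleton_subset_iff.2 hX'M))
        (hlim.mem_hyperVertices hvlim)
  · rw [← D.arcTargets_limitGraph_descendants hX'M hv' hv's,
      ← D.arcTargets_limitGraph_descendants hX hvX hvn, hlim.encard_arcTargets_eq hvlim]

end IsDerivation

variable {k : ℕ} {μ : Fin k → ℝ}

/-- The condition `HasUnitWeightAt` for a vertex of `M n` in the graph generated along `M`, as it
can be read off from `M (n + K)` and `M (n + 3 * K + 1)`, where `K` is the pumping constant. -/
def HasUnitWeightAtStage (G : HRGrammar) (μ : Fin k → ℝ) (M : ℕ → Set Hyperarc) (n v : ℕ) :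
    Prop :=
  (∀ a : Fin k, arcTargets (M (n + 3 * G.typeBound + 1)) v a ⊆
      hyperVertices (M (n + G.typeBound))) ∧
    ∑ a : Fin k, μ a * ((arcTargets (M (n + 3 * G.typeBound + 1)) v a).ncard : ℝ) = 1

namespace IsDerivation

theorem hasUnitWeightAt_limitGraph_iff (D : G.IsDerivation M h) (hfin : ∀ n, (M n).Finite)
    {n v : ℕ} (hv : v ∈ hyperVertices (M n)) :
    HasUnitWeightAt μ (limitGraph M) v ↔ G.HasUnitWeightAtStage μ M n v := by
  simp only [HasUnitWeightAt, HasUnitWeightAtStage, ← D.finite_arcTargets_limitGraph_iff hfin hv]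
  refine and_congr_right fun hf => ?_
  have heq : ∀ a : Fin k, arcTargets (limitGraph M) v a =
      arcTargets (M (n + 3 * G.typeBound + 1)) v a := fun a =>
    D.arcTargets_limitGraph_eq
      (D.monotone_hyperVertices (Nat.le_add_right n G.typeBound) hv)
      (D.arcTargets_subset_hyperVertices_of_finite hv (hf a)) (by lia)
  simp only [heq]

theorem forall_hasUnitWeightAt_iff (D : G.IsDerivation M h) (hM : hyperVertices (M 0) = ∅)
    (hfin : ∀ n, (M n).Finite) :
    (∀ v ∈ hyperVertices (limitGraph M), HasUnitWeightAt μ (limitGraph M) v) ↔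
      ∀ v ∈ hyperVertices (terminalPart (M (2 * G.typeBound + 1))),
        G.HasUnitWeightAtStage μ M (2 * G.typeBound + 1) v := by
  have hstage : ∀ v ∈ hyperVertices (terminalPart (M (2 * G.typeBound + 1))),
      (HasUnitWeightAt μ (limitGraph M) v ↔
        G.HasUnitWeightAtStage μ M (2 * G.typeBound + 1) v) := fun v hv =>
    D.hasUnitWeightAt_limitGraph_iff hfin (hyperVertices_mono (terminalPart_subset _) hv)
  refine ⟨fun H v hv => (hstage v hv).1
    (H v (hyperVertices_mono (terminalPart_subset_limitGraph M _) hv)), fun H v hv => ?_⟩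
  obtain ⟨v', hv', heq⟩ := D.exists_early_vertex hM hv
  exact (hasUnitWeightAt_congr heq).1 ((hstage v' hv').2 (H v' hv'))

end IsDerivation

theorem mem_generatedGraphs_iff (hG : G.IsValid) {H : Set Hyperarc} :
    H ∈ G.generatedGraphs ↔ ∃ M h, G.IsDerivation M h ∧
      M 0 = {(HRSymbol.nonterminal G.start, [])} ∧ H = limitGraph M := by
  constructor
  · rintro ⟨M, hM0, hM, rfl⟩
    simp only [parallelRewrites_iff] at hM
    choose h hrew hsucc using hM
    refine ⟨M, h, ⟨hG, ?_, hrew, hsucc⟩, hM0, rfl⟩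
    rw [hM0]
    rintro _ rfl
    exact ⟨hG.start_mem, hG.start_arity.symm⟩
  · rintro ⟨M, h, D, hM0, rfl⟩
    exact ⟨M, hM0, fun n => parallelRewrites_iff.2 ⟨h n, D.isRewriting n, D.succ n⟩, rfl⟩

theorem IsDerivation.isProbabilistic_iff (D : G.IsDerivation M h)
    (hM0 : M 0 = {(HRSymbol.nonterminal G.start, [])}) {μ : Fin G.arcLabels → ℝ} :
    G.IsProbabilistic μ ↔ (∀ a, μ a ∈ Set.Icc (0 : ℝ) 1) ∧
      ∀ v ∈ hyperVertices (limitGraph M), HasUnitWeightAt μ (limitGraph M) v := by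
  constructor
  · intro P
    have hM := (mem_generatedGraphs_iff D.valid).2 ⟨M, h, D, hM0, rfl⟩
    exact ⟨P.weight_mem, fun v hv => ⟨P.finite_arcs _ hM v hv, P.sum_eq_one _ hM v hv⟩⟩
  · rintro ⟨hμ, hM⟩
    have hall : ∀ H ∈ G.generatedGraphs, ∀ v ∈ hyperVertices H, HasUnitWeightAt μ H v := by
      intro H hH
      obtain ⟨M', h', D', hM0', rfl⟩ := (mem_generatedGraphs_iff D.valid).1 hH
      obtain ⟨Φ, -, hΦ⟩ := D.exists_isIsoOn D' (φ := id)
        (by rw [hM0, hM0']; exact IsIsoOn.singleton (Set.injOn_id _))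
      exact (IsIsoOn.hasUnitWeightAt_iff (D.isIsoOn_limitGraph hΦ)).2 hM
    exact ⟨D.valid, hμ, fun H hH v hv => (hall H hH v hv).1, fun H hH v hv => (hall H hH v hv).2⟩

end HRGrammar

/-! ### Computability of lists and finite hypergraphs -/

section Computability

variable {α β : Type*} [Primcodable α] [Primcodable β]

theorem computablePred_and {p q : α → Prop} (hp : ComputablePred p) (hq : ComputablePred q) :
    ComputablePred fun a => p a ∧ q a := by
  obtain ⟨f, hf, rfl⟩ := ComputablePred.computable_iff.1 hp
  obtain ⟨g, hg, rfl⟩ := ComputablePred.computable_iff.1 hq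
  refine ComputablePred.computable_iff.2
    ⟨fun a => f a && g a, Primrec.and.to_comp.comp hf hg, ?_⟩
  simp only [Bool.and_eq_true]

theorem computablePred_comp {p : β → Prop} (hp : ComputablePred p) {f : α → β}
    (hf : Computable f) : ComputablePred fun a => p (f a) :=
  ComputablePred.computable_of_manyOneReducible ⟨f, hf, fun _ => Iff.rfl⟩ hp

theorem computable_list_all {l : α → List β} {f : α → β → Bool} (hl : Computable l)
    (hf : Computable₂ f) : Computable fun a => (l a).all (f a) := by
  have hstep : Computable₂ fun (a : α) (t : ℕ × Bool) =>
      t.2 && ((l a)[t.1]?.map (f a)).getD true :=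
    Primrec.and.to_comp.comp (Computable.snd.comp Computable.snd)
      (Computable.option_getD
        (Computable.option_map
          (Computable.list_getElem?.comp (hl.comp Computable.fst)
            (Computable.fst.comp Computable.snd))
          (hf.comp (Computable.fst.comp Computable.fst) Computable.snd))
        (Computable.const true))
  have htake : ∀ a n, (Nat.rec true (fun i b => b && ((l a)[i]?.map (f a)).getD true) n : Bool) =
      ((l a).take n).all (f a) := by
    intro a n
    induction n with
    | zero => rfl
    | succ n ih =>
      rw [List.take_add_one, List.all_append, ← ih]
      cases hb : (l a)[n]? <;> simp [hb]
  refine (Computable.nat_rec (Computable.list_length.comp hl) (Computable.const true)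
    hstep).of_eq fun a => ?_
  rw [htake, List.take_length]

theorem computablePred_forall_mem_list {l : α → List β} {R : α → β → Prop} (hl : Computable l)
    (hR : ComputablePred fun t : α × β => R t.1 t.2) :
    ComputablePred fun a => ∀ b ∈ l a, R a b := by
  obtain ⟨f, hf, hRf⟩ := ComputablePred.computable_iff.1 hR
  have hR' : ∀ a b, R a b ↔ f (a, b) = true := fun a b => iff_of_eq (congrFun hRf (a, b))
  refine ComputablePred.computable_iff.2
    ⟨_, computable_list_all hl (f := fun a b => f (a, b)) hf, ?_⟩
  simp only [hR', List.all_eq_true]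

theorem primrecPred_forall_mem_list {l : α → List β} {R : α → β → Prop} (hl : Primrec l)
    (hR : PrimrecRel R) : PrimrecPred fun a => ∀ b ∈ l a, R a b :=
  hR.swap.forall_mem_list.comp hl Primrec.id

theorem primrecPred_forall_lt {n : α → ℕ} {R : α → ℕ → Prop} (hn : Primrec n)
    (hR : PrimrecRel R) : PrimrecPred fun a => ∀ i < n a, R a i :=
  (primrecPred_forall_mem_list (Primrec.list_range.comp hn) hR).of_eq fun _ => by
    simp only [List.mem_range]

theorem primrecPred_exists_lt {n : α → ℕ} {R : α → ℕ → Prop} (hn : Primrec n)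
    (hR : PrimrecRel R) : PrimrecPred fun a => ∃ i < n a, R a i :=
  (hR.swap.exists_mem_list.comp (Primrec.list_range.comp hn) Primrec.id).of_eq fun _ => by
    simp only [List.mem_range, Function.swap, id_eq]

theorem primrecRel_mem_list : PrimrecRel fun (a : α) (l : List α) => a ∈ l :=
  (PrimrecRel.exists_mem_list (Primrec.eq (α := α))).swap.of_eq fun a l => by simp

theorem primrec_list_sum : Primrec (List.sum : List ℕ → ℕ) :=
  Primrec.list_foldr Primrec.id (Primrec.const 0)
    ((Primrec.nat_add.comp (Primrec.fst.comp Primrec.snd) (Primrec.snd.comp Primrec.snd)).to₂)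

theorem primrec_equalityPattern [DecidableEq α] :
    Primrec (equalityPattern : List α → List ℕ) :=
  Primrec.list_map Primrec.id (Primrec.list_idxOf.comp Primrec.snd Primrec.fst).to₂

theorem primrecPred_nodup : PrimrecPred (List.Nodup : List α → Prop) := by
  classical
  exact (Primrec.eq.comp primrec_equalityPattern
    (Primrec.list_range.comp Primrec.list_length)).of_eq fun _ => nodup_iff_equalityPattern_eq.symm

end Computability

namespace HRSymbol

theorem primrec_equivSum : Primrec equivSum := Primrec.of_equiv

theorem primrec_equivSum_symm : Primrec equivSum.symm := Primrec.of_equiv_symm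

theorem primrec_nonterminal : Primrec nonterminal :=
  primrec_equivSum_symm.comp Primrec.sumInl

theorem primrec_colour : Primrec colour :=
  primrec_equivSum_symm.comp (Primrec.sumInr.comp Primrec.sumInr)

theorem primrec_arcLabel : Primrec arcLabel :=
  primrec_equivSum_symm.comp (Primrec.sumInr.comp Primrec.sumInl)

/-- The number of a non-terminal, and `none` for a terminal. -/
def nonterminal? : HRSymbol → Option ℕ
  | nonterminal A => some A
  | _ => none

theorem primrec_nonterminal? : Primrec nonterminal? :=
  (Primrec.sumCasesOn primrec_equivSum (Primrec.option_some.comp Primrec.snd).to₂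
    (Primrec.const none).to₂).of_eq fun s => by cases s <;> rfl

instance : DecidableEq HRSymbol := equivSum.decidableEq

end HRSymbol

/-- The vertices of a finite hypergraph, given as a list of hyperarcs. -/
def vertexList (L : List Hyperarc) : List ℕ := L.flatMap Prod.snd

/-- A number that is larger than all vertices of a finite hypergraph. -/
def vertexBound (L : List Hyperarc) : ℕ := (vertexList L).sum + 1

/-- The terminal hyperarcs of a finite hypergraph. -/
def terminalList (L : List Hyperarc) : List Hyperarc := L.filter fun X => X.1.nonterminal? = none

/-- The targets of the `a`-labelled arcs from `v` in a finite hypergraph, without repetitions. -/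
def targetList (L : List Hyperarc) (v a : ℕ) : List ℕ :=
  (List.range (vertexBound L)).filter fun u => (HRSymbol.arcLabel a, [v, u]) ∈ L

/-- For each label `a`, the number of `a`-labelled arcs from `v` in a finite hypergraph, paired
with the weight of `a`. -/
def weightList {K : Type*} (L : List Hyperarc) (μ : List K) (v : ℕ) : List (ℕ × K) :=
  (List.range μ.length).filterMap fun a => μ[a]?.map fun k => ((targetList L v a).length, k)

section FiniteHypergraph

variable {L : List Hyperarc}

theorem mem_vertexList {v : ℕ} : v ∈ vertexList L ↔ v ∈ hyperVertices {X | X ∈ L} :=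
  List.mem_flatMap

theorem lt_vertexBound {v : ℕ} (hv : v ∈ hyperVertices {X | X ∈ L}) : v < vertexBound L :=
  Nat.lt_succ_of_le (List.single_le_sum (fun _ _ => Nat.zero_le _) _ (mem_vertexList.2 hv))

theorem mem_terminalList {X : Hyperarc} :
    X ∈ terminalList L ↔ X ∈ terminalPart {X | X ∈ L} := by
  obtain ⟨s, l⟩ := X
  cases s <;> simp [terminalList, terminalPart, HRSymbol.nonterminal?]

theorem mem_targetList {v a u : ℕ} :
    u ∈ targetList L v a ↔ u ∈ arcTargets {X | X ∈ L} v a := by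
  rw [targetList, List.mem_filter, List.mem_range, decide_eq_true_eq]
  exact and_iff_right_of_imp fun h => lt_vertexBound ⟨_, h, by simp⟩

theorem length_targetList (L : List Hyperarc) (v a : ℕ) :
    (targetList L v a).length = (arcTargets {X | X ∈ L} v a).ncard := by
  have hnodup : (targetList L v a).Nodup := List.nodup_range.filter _
  rw [← List.toFinset_card_of_nodup hnodup, ← Set.ncard_coe_finset]
  congr 1
  ext u
  simp [mem_targetList]

theorem weightList_eq_ofFn {K : Type*} (L : List Hyperarc) (μ : List K) (v : ℕ) :
    weightList L μ v =
      List.ofFn fun a : Fin μ.length => ((targetList L v a).length, μ.get a) := by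
  rw [weightList, ← List.map_coe_finRange_eq_range, List.filterMap_map, List.ofFn_eq_map,
    ← List.filterMap_eq_map]
  exact List.filterMap_congr fun a _ => by simp

theorem sum_weightList {K : Type*} (val : K → ℝ) (L : List Hyperarc) (μ : List K) {k : ℕ}
    (hlen : μ.length = k) (v : ℕ) :
    ((weightList L μ v).map fun t => (t.1 : ℝ) * val t.2).sum =
      ∑ a : Fin k, val (μ.get (Fin.cast hlen.symm a)) *
        ((arcTargets {X | X ∈ L} v a).ncard : ℝ) := by
  subst hlen
  simp [weightList_eq_ofFn, List.map_ofFn, List.sum_ofFn, length_targetList, mul_comm]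

end FiniteHypergraph

section PrimrecFiniteHypergraph

variable {α : Type*} [Primcodable α] {L : α → List Hyperarc} {v a : α → ℕ}

theorem primrec_vertexList : Primrec vertexList :=
  Primrec.list_flatMap Primrec.id (Primrec.snd.comp Primrec.snd).to₂

theorem primrec_vertexBound : Primrec vertexBound :=
  Primrec.succ.comp (primrec_list_sum.comp primrec_vertexList)

theorem primrec_terminalList : Primrec terminalList :=
  Primrec.listFilter (Primrec.eq.comp (HRSymbol.primrec_nonterminal?.comp Primrec.fst)
    (Primrec.const none))

theorem primrec_targetList (hL : Primrec L) (hv : Primrec v) (ha : Primrec a) :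
    Primrec fun x => targetList (L x) (v x) (a x) := by
  have harc : PrimrecRel fun (u : ℕ) (x : α) =>
      (HRSymbol.arcLabel (a x), [v x, u]) ∈ L x := by
    refine primrecRel_mem_list.comp (Primrec.pair ?_ ?_) (hL.comp Primrec.snd)
    · exact HRSymbol.primrec_arcLabel.comp (ha.comp Primrec.snd)
    · exact Primrec.list_cons.comp (hv.comp Primrec.snd)
        (Primrec.list_cons.comp Primrec.fst (Primrec.const []))
  exact harc.listFilter.comp (Primrec.list_range.comp (primrec_vertexBound.comp hL)) Primrec.id

theorem primrec_weightList {K : Type*} [Primcodable K] {μ : α → List K} (hL : Primrec L)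
    (hμ : Primrec μ) (hv : Primrec v) : Primrec fun x => weightList (L x) (μ x) (v x) := by
  have hcount : Primrec fun t : (α × ℕ) × K => (targetList (L t.1.1) (v t.1.1) t.1.2).length :=
    Primrec.list_length.comp (primrec_targetList (hL.comp (Primrec.fst.comp Primrec.fst))
      (hv.comp (Primrec.fst.comp Primrec.fst)) (Primrec.snd.comp Primrec.fst))
  exact Primrec.listFilterMap (Primrec.list_range.comp (Primrec.list_length.comp hμ))
    (Primrec.option_map (Primrec.list_getElem?.comp (hμ.comp Primrec.fst) Primrec.snd)
      (hcount.pair Primrec.snd).to₂).to₂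

end PrimrecFiniteHypergraph

/-! ### Simulation of a derivation -/

namespace HRGrammar

variable {G : HRGrammar}

theorem primrec_equivProd : Primrec equivProd := Primrec.of_equiv

theorem primrec_rules : Primrec rules := Primrec.fst.comp primrec_equivProd

theorem primrec_arcLabels : Primrec arcLabels :=
  Primrec.fst.comp (Primrec.snd.comp primrec_equivProd)

theorem primrec_colours : Primrec colours :=
  Primrec.fst.comp (Primrec.snd.comp (Primrec.snd.comp primrec_equivProd))

theorem primrec_start : Primrec start :=
  Primrec.snd.comp (Primrec.snd.comp (Primrec.snd.comp primrec_equivProd))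

/-- The hyperarcs of `H_A`, as a list. -/
def rhsList (G : HRGrammar) (A : ℕ) : List Hyperarc := (G.rules.getD A ([], [])).1

theorem primrec_rhsList : Primrec₂ rhsList :=
  Primrec.fst.comp
    ((Primrec.list_getD ([], [])).comp (primrec_rules.comp Primrec.fst) Primrec.snd)

theorem primrec_inputs : Primrec₂ inputs :=
  Primrec.snd.comp
    ((Primrec.list_getD ([], [])).comp (primrec_rules.comp Primrec.fst) Primrec.snd)

theorem primrec_arity : Primrec₂ arity := Primrec.list_length.comp primrec_inputs

theorem primrec_length_rules : Primrec fun G : HRGrammar => G.rules.length :=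
  Primrec.list_length.comp primrec_rules

theorem primrec_symbolCount : Primrec symbolCount :=
  Primrec.nat_add.comp (Primrec.nat_add.comp primrec_length_rules primrec_arcLabels)
    primrec_colours

theorem primrec_lengthBound : Primrec lengthBound :=
  Primrec.nat_add.comp (Primrec.const 2) (primrec_list_sum.comp
    (Primrec.list_map primrec_rules
      (Primrec.list_length.comp (Primrec.snd.comp Primrec.snd)).to₂))

theorem primrec_typeBound : Primrec typeBound := by
  have hpow : Primrec₂ fun m n : ℕ => m ^ n := Primrec₂.unpaired'.1 Nat.Primrec.pow
  have hlen : Primrec fun G : HRGrammar => G.lengthBound + 2 :=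
    Primrec.nat_add.comp primrec_lengthBound (Primrec.const 2)
  exact Primrec.nat_mul.comp primrec_symbolCount (hpow.comp hlen hlen)

theorem isHyperarc_iff {X : Hyperarc} : G.IsHyperarc X ↔
    (∃ B < G.rules.length, X.1 = HRSymbol.nonterminal B ∧ X.2.length = G.arity B) ∨
    (∃ a < G.arcLabels, X.1 = HRSymbol.arcLabel a ∧ X.2.length = 2) ∨
    ∃ c < G.colours, X.1 = HRSymbol.colour c ∧ X.2.length = 1 := by
  obtain ⟨_ | _ | _, l⟩ := X <;> simp [IsHyperarc]

theorem primrecRel_isHyperarc : PrimrecRel IsHyperarc := by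
  have hsymbol : Primrec fun t : (HRGrammar × Hyperarc) × ℕ => t.1.2.1 :=
    Primrec.fst.comp (Primrec.snd.comp Primrec.fst)
  have hlength : Primrec fun t : (HRGrammar × Hyperarc) × ℕ => t.1.2.2.length :=
    Primrec.list_length.comp (Primrec.snd.comp (Primrec.snd.comp Primrec.fst))
  have hnonterminal : PrimrecRel fun (p : HRGrammar × Hyperarc) B =>
      p.2.1 = HRSymbol.nonterminal B ∧ p.2.2.length = p.1.arity B :=
    (Primrec.eq.comp hsymbol (HRSymbol.primrec_nonterminal.comp Primrec.snd)).and
      (Primrec.eq.comp hlength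
        (primrec_arity.comp (Primrec.fst.comp Primrec.fst) Primrec.snd))
  have harcLabel : PrimrecRel fun (p : HRGrammar × Hyperarc) a =>
      p.2.1 = HRSymbol.arcLabel a ∧ p.2.2.length = 2 :=
    (Primrec.eq.comp hsymbol (HRSymbol.primrec_arcLabel.comp Primrec.snd)).and
      (Primrec.eq.comp hlength (Primrec.const 2))
  have hcolour : PrimrecRel fun (p : HRGrammar × Hyperarc) c =>
      p.2.1 = HRSymbol.colour c ∧ p.2.2.length = 1 :=
    (Primrec.eq.comp hsymbol (HRSymbol.primrec_colour.comp Primrec.snd)).and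
      (Primrec.eq.comp hlength (Primrec.const 1))
  exact ((primrecPred_exists_lt (primrec_length_rules.comp Primrec.fst) hnonterminal).or
    ((primrecPred_exists_lt (primrec_arcLabels.comp Primrec.fst) harcLabel).or
      (primrecPred_exists_lt (primrec_colours.comp Primrec.fst) hcolour))).of_eq
    fun _ => isHyperarc_iff.symm

theorem isValid_iff : G.IsValid ↔ G.start < G.rules.length ∧ G.arity G.start = 0 ∧
    ∀ A < G.rules.length, (∀ X ∈ G.rhsList A, G.IsHyperarc X) ∧ (G.inputs A).Nodup ∧
      ∀ v ∈ G.inputs A, v ∈ vertexList (G.rhsList A) := by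
  have hmem : ∀ A v, v ∈ vertexList (G.rhsList A) ↔ v ∈ hyperVertices (G.rhs A) :=
    fun A v => mem_vertexList
  simp only [hmem]
  exact ⟨fun h => ⟨h.1, h.2, fun A hA => ⟨h.3 A hA, h.4 A hA, h.5 A hA⟩⟩,
    fun ⟨hZ, hρ, h⟩ => ⟨hZ, hρ, fun A hA => (h A hA).1, fun A hA => (h A hA).2.1,
      fun A hA => (h A hA).2.2⟩⟩

theorem primrecPred_isValid : PrimrecPred IsValid := by
  have hrhs : PrimrecRel fun (G : HRGrammar) A => ∀ X ∈ G.rhsList A, G.IsHyperarc X :=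
    primrecPred_forall_mem_list primrec_rhsList
      (primrecRel_isHyperarc.comp (Primrec.fst.comp Primrec.fst) Primrec.snd)
  have hmem : PrimrecRel fun (G : HRGrammar) A =>
      ∀ v ∈ G.inputs A, v ∈ vertexList (G.rhsList A) :=
    primrecPred_forall_mem_list primrec_inputs
      (primrecRel_mem_list.comp Primrec.snd
        ((primrec_vertexList.comp primrec_rhsList).comp Primrec.fst))
  have hrules := primrecPred_forall_lt (R := fun (G : HRGrammar) A =>
    (∀ X ∈ G.rhsList A, G.IsHyperarc X) ∧ (G.inputs A).Nodup ∧
      ∀ v ∈ G.inputs A, v ∈ vertexList (G.rhsList A))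
    primrec_length_rules (hrhs.and ((primrecPred_nodup.comp primrec_inputs).and hmem))
  exact ((Primrec.nat_lt.comp primrec_start primrec_length_rules).and
    ((Primrec.eq.comp (primrec_arity.comp Primrec.id primrec_start) (Primrec.const 0)).and
      hrules)).of_eq fun _ => isValid_iff.symm

/-- The map along which the hyperarc `A vs` is replaced in the simulation. The inner vertex `w` of
`H_A` is sent to a number that is at least `b` and determines `A`, `vs` and `w`. -/
def freshMap (G : HRGrammar) (b A : ℕ) (vs : List ℕ) (w : ℕ) : ℕ :=
  vs[(G.inputs A).idxOf w]?.getD (b + Nat.pair (Encodable.encode (A, vs)) w)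

/-- The hyperarcs that replace `X` in the simulation. -/
def replaceHyperarc (G : HRGrammar) (b : ℕ) (X : Hyperarc) : List Hyperarc :=
  (X.1.nonterminal?.map fun A =>
    (G.rhsList A).map (Hyperarc.mapVertices (G.freshMap b A X.2))).getD [X]

/-- The hypergraph `M n` of one particular derivation of `G`, as a list. -/
def simulate (G : HRGrammar) : ℕ → List Hyperarc
  | 0 => [(HRSymbol.nonterminal G.start, [])]
  | n + 1 => (G.simulate n).flatMap (G.replaceHyperarc (vertexBound (G.simulate n)))

/-- The choice of new vertices along the derivation `simulate G`. -/
def simulateMap (G : HRGrammar) (n : ℕ) : ℕ → List ℕ → ℕ → ℕ :=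
  G.freshMap (vertexBound (G.simulate n))

theorem setOf_mem_flatMap_replaceHyperarc (b : ℕ) (L : List Hyperarc) :
    {Y | Y ∈ L.flatMap (G.replaceHyperarc b)} = G.rewrite (G.freshMap b) {X | X ∈ L} := by
  ext Y
  rw [mem_rewrite_iff, Set.mem_ofPred_eq, List.mem_flatMap]
  refine exists_congr fun X => and_congr_right fun _ => ?_
  obtain ⟨A | a | c, vs⟩ := X
  · have hterminal : Y ∉ terminalPart {(HRSymbol.nonterminal A, vs)} := by
      rintro ⟨rfl, hY⟩
      exact hY A rfl
    simp [replaceHyperarc, rewrite, hterminal, rhs, rhsList, HRSymbol.nonterminal?, eq_comm]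
  all_goals
    simp only [replaceHyperarc, rewrite, terminalPart, HRSymbol.nonterminal?, Option.map_none]
    simp +contextual

theorem freshMap_of_mem_innerVertices {b A w : ℕ} {vs : List ℕ}
    (hvs : vs.length = G.arity A) (hw : w ∈ G.innerVertices A) :
    G.freshMap b A vs w = b + Nat.pair (Encodable.encode (A, vs)) w := by
  rw [freshMap, List.idxOf_eq_length hw.2, ← arity, List.getElem?_eq_none hvs.le, Option.getD_none]

theorem map_freshMap_inputs {b A : ℕ} {vs : List ℕ} (hA : (G.inputs A).Nodup)
    (hvs : vs.length = G.arity A) : (G.inputs A).map (G.freshMap b A vs) = vs := by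
  refine List.ext_getElem (by rw [List.length_map, hvs, arity]) fun i hi hi' => ?_
  rw [List.getElem_map, freshMap, hA.idxOf_getElem, List.getElem?_eq_getElem hi',
    Option.getD_some]

theorem freshMap_inj {b A B w u : ℕ} {vs ws : List ℕ} (hvs : vs.length = G.arity A)
    (hws : ws.length = G.arity B) (hw : w ∈ G.innerVertices A) (hu : u ∈ G.innerVertices B)
    (h : G.freshMap b A vs w = G.freshMap b B ws u) : (A, vs) = (B, ws) ∧ w = u := by
  rw [freshMap_of_mem_innerVertices hvs hw, freshMap_of_mem_innerVertices hws hu] at h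
  obtain ⟨hcode, hwu⟩ := Nat.pair_eq_pair.1 (Nat.add_left_cancel h)
  exact ⟨Encodable.encode_injective hcode, hwu⟩

theorem isRewriting_freshMap (hG : G.IsValid) {L : List Hyperarc}
    (hL : ∀ X ∈ L, G.IsHyperarc X) :
    G.IsRewriting (G.freshMap (vertexBound L)) {X | X ∈ L} where
  repl A vs hA :=
    { map_inputs := map_freshMap_inputs (hG.inputs_injective A (hL _ hA).1) (hL _ hA).2
      injOn _ hw _ hu h := (freshMap_inj (hL _ hA).2 (hL _ hA).2 hw hu h).2
      fresh w hw hwL := by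
        have hlt := lt_vertexBound hwL
        rw [freshMap_of_mem_innerVertices (hL _ hA).2 hw] at hlt
        lia }
  disj A vs B ws hA hB hne := by
    rw [Set.disjoint_left]
    rintro _ ⟨w, hw, rfl⟩ ⟨u, hu, h⟩
    exact hne (freshMap_inj (hL _ hB).2 (hL _ hA).2 hu hw h).1.symm

theorem isDerivation_simulate (hG : G.IsValid) :
    G.IsDerivation (fun n => {X | X ∈ G.simulate n}) G.simulateMap := by
  have hzero : ∀ X ∈ G.simulate 0, G.IsHyperarc X := by
    intro X hX
    obtain rfl := List.mem_singleton.1 hX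
    exact ⟨hG.start_mem, hG.start_arity.symm⟩
  have hsucc : ∀ n, {X | X ∈ G.simulate (n + 1)} =
      G.rewrite (G.simulateMap n) {X | X ∈ G.simulate n} :=
    fun n => setOf_mem_flatMap_replaceHyperarc _ _
  have hsim : ∀ n, ∀ X ∈ G.simulate n, G.IsHyperarc X := by
    intro n
    induction n with
    | zero => exact hzero
    | succ n ih => exact fun X hX => IsHyperarc.rewrite hG ih X ((hsucc n).subset hX)
  exact ⟨hG, hzero, fun n => isRewriting_freshMap hG (hsim n), hsucc⟩

theorem primrec_freshMap {α : Type*} [Primcodable α] {g : α → HRGrammar} {b A w : α → ℕ}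
    {vs : α → List ℕ} (hg : Primrec g) (hb : Primrec b) (hA : Primrec A) (hvs : Primrec vs)
    (hw : Primrec w) : Primrec fun x => (g x).freshMap (b x) (A x) (vs x) (w x) :=
  Primrec.option_getD.comp
    (Primrec.list_getElem?.comp hvs (Primrec.list_idxOf.comp hw (primrec_inputs.comp hg hA)))
    (Primrec.nat_add.comp hb
      (Primrec₂.natPair.comp (Primrec.encode.comp (hA.pair hvs)) hw))

theorem primrec_replaceHyperarc :
    Primrec fun t : (HRGrammar × ℕ) × Hyperarc => t.1.1.replaceHyperarc t.1.2 t.2 := by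
  have hmap : Primrec₂ fun (t : ((HRGrammar × ℕ) × Hyperarc) × ℕ) (X : Hyperarc) =>
      X.mapVertices (t.1.1.1.freshMap t.1.1.2 t.2 t.1.2.2) := by
    have hfst : Primrec fun q : ((((HRGrammar × ℕ) × Hyperarc) × ℕ) × Hyperarc) × ℕ => q.1.1 :=
      Primrec.fst.comp Primrec.fst
    exact Primrec.pair (Primrec.fst.comp Primrec.snd)
      (Primrec.list_map (Primrec.snd.comp Primrec.snd)
        (primrec_freshMap (Primrec.fst.comp (Primrec.fst.comp (Primrec.fst.comp hfst)))
          (Primrec.snd.comp (Primrec.fst.comp (Primrec.fst.comp hfst)))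
          (Primrec.snd.comp hfst)
          (Primrec.snd.comp (Primrec.snd.comp (Primrec.fst.comp hfst))) Primrec.snd))
  have hrhs : Primrec fun t : ((HRGrammar × ℕ) × Hyperarc) × ℕ => t.1.1.1.rhsList t.2 :=
    primrec_rhsList.comp (Primrec.fst.comp (Primrec.fst.comp Primrec.fst)) Primrec.snd
  have hnonterminal : Primrec fun t : (HRGrammar × ℕ) × Hyperarc => t.2.1.nonterminal? :=
    HRSymbol.primrec_nonterminal?.comp (Primrec.fst.comp Primrec.snd)
  exact Primrec.option_getD.comp
    (Primrec.option_map hnonterminal (Primrec.list_map hrhs hmap).to₂)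
    (Primrec.list_cons.comp Primrec.snd (Primrec.const []))

theorem primrec_simulate : Primrec₂ simulate := by
  have hzero : Primrec fun G : HRGrammar => [((HRSymbol.nonterminal G.start, []) : Hyperarc)] :=
    Primrec.list_cons.comp ((HRSymbol.primrec_nonterminal.comp primrec_start).pair
      (Primrec.const [])) (Primrec.const [])
  have hsucc : Primrec₂ fun (G : HRGrammar) (t : ℕ × List Hyperarc) =>
      t.2.flatMap (G.replaceHyperarc (vertexBound t.2)) := by
    have hL : Primrec fun q : HRGrammar × ℕ × List Hyperarc => q.2.2 :=
      Primrec.snd.comp Primrec.snd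
    exact Primrec.list_flatMap hL (primrec_replaceHyperarc.comp
      (((Primrec.fst.comp Primrec.fst).pair
        (primrec_vertexBound.comp (hL.comp Primrec.fst))).pair Primrec.snd)).to₂
  refine (Primrec.nat_rec hzero hsucc).of_eq fun G n => ?_
  induction n with
  | zero => rfl
  | succ n ih => rw [simulate, ← ih]

theorem primrec_simulate_stage (c d : ℕ) :
    Primrec fun G : HRGrammar => G.simulate (c * G.typeBound + d) :=
  primrec_simulate.comp Primrec.id (Primrec.nat_add.comp
    (Primrec.nat_mul.comp (Primrec.const c) primrec_typeBound) (Primrec.const d))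

theorem isProbabilistic_iff_simulate (hG : G.IsValid) {μ : Fin G.arcLabels → ℝ} :
    G.IsProbabilistic μ ↔ (∀ a, μ a ∈ Set.Icc (0 : ℝ) 1) ∧
      ∀ v ∈ vertexList (terminalList (G.simulate (2 * G.typeBound + 1))),
        G.HasUnitWeightAtStage μ (fun n => {X | X ∈ G.simulate n}) (2 * G.typeBound + 1) v := by
  have D := isDerivation_simulate hG
  have hzero : {X | X ∈ G.simulate 0} = {(HRSymbol.nonterminal G.start, [])} :=
    Set.ext fun _ => List.mem_singleton
  have hempty : hyperVertices {X | X ∈ G.simulate 0} = ∅ := by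
    simp [hzero, hyperVertices]
  rw [D.isProbabilistic_iff hzero, D.forall_hasUnitWeightAt_iff hempty fun n => List.finite_toSet _]
  simp only [mem_vertexList, mem_terminalList]
  rfl

theorem hasUnitWeightAtStage_simulate_iff {K : Type*} {val : K → ℝ} {μ : List K}
    (hlen : μ.length = G.arcLabels) {n v : ℕ} :
    G.HasUnitWeightAtStage (fun a : Fin G.arcLabels => val (μ.get (Fin.cast hlen.symm a)))
        (fun n => {X | X ∈ G.simulate n}) n v ↔
      (∀ a < G.arcLabels, ∀ u ∈ targetList (G.simulate (n + 3 * G.typeBound + 1)) v a,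
        u ∈ vertexList (G.simulate (n + G.typeBound))) ∧
      ((weightList (G.simulate (n + 3 * G.typeBound + 1)) μ v).map
        fun t => (t.1 : ℝ) * val t.2).sum = 1 := by
  rw [HasUnitWeightAtStage, sum_weightList val _ μ hlen, Fin.forall_iff]
  simp only [mem_vertexList, mem_targetList]
  rfl

theorem isPHRInstance_iff {K : Type} {val : K → ℝ} {μ : List K} :
    IsPHRInstance val (G, μ) ↔ (μ.length = G.arcLabels ∧ G.IsValid) ∧
      (∀ k ∈ μ, val k ∈ Set.Icc (0 : ℝ) 1) ∧
      ∀ v ∈ vertexList (terminalList (G.simulate (2 * G.typeBound + 1))),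
        (∀ a < G.arcLabels, ∀ u ∈ targetList (G.simulate (5 * G.typeBound + 2)) v a,
          u ∈ vertexList (G.simulate (3 * G.typeBound + 1))) ∧
        ((weightList (G.simulate (5 * G.typeBound + 2)) μ v).map
          fun t => (t.1 : ℝ) * val t.2).sum = 1 := by
  by_cases hinst : μ.length = G.arcLabels ∧ G.IsValid
  swap
  · exact iff_of_false (fun ⟨hlen, P⟩ => hinst ⟨hlen, P.valid⟩) fun h => hinst h.1
  obtain ⟨hlen, hG⟩ := hinst
  have hmem : (∀ a : Fin G.arcLabels, val (μ.get (Fin.cast hlen.symm a)) ∈ Set.Icc (0 : ℝ) 1) ↔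
      ∀ k ∈ μ, val k ∈ Set.Icc (0 : ℝ) 1 := by
    rw [(finCongr hlen.symm).forall_congr_left]
    simp [List.forall_mem_iff_get]
  rw [IsPHRInstance, exists_prop_of_true hlen, isProbabilistic_iff_simulate hG, hmem,
    and_iff_right (⟨hlen, hG⟩ : _ ∧ _)]
  simp only [hasUnitWeightAtStage_simulate_iff hlen,
    show 2 * G.typeBound + 1 + G.typeBound = 3 * G.typeBound + 1 by ring,
    show 2 * G.typeBound + 1 + 3 * G.typeBound + 1 = 5 * G.typeBound + 2 by ring]

theorem computablePred_isPHRInstance {K : Type} [Primcodable K] {val : K → ℝ}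
    (hmem : ComputablePred fun k : K => val k ∈ Set.Icc (0 : ℝ) 1)
    (hsum : ComputablePred fun l : List (ℕ × K) =>
      (l.map (fun t => (t.1 : ℝ) * val t.2)).sum = 1) :
    ComputablePred fun p : HRGrammar × List K => IsPHRInstance val p := by
  have hdata : PrimrecPred fun p : HRGrammar × List K =>
      p.2.length = p.1.arcLabels ∧ p.1.IsValid :=
    (Primrec.eq.comp (Primrec.list_length.comp Primrec.snd)
      (primrec_arcLabels.comp Primrec.fst)).and (primrecPred_isValid.comp Primrec.fst)
  have htargets : PrimrecPred fun t : (HRGrammar × List K) × ℕ => ∀ a < t.1.1.arcLabels,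
      ∀ u ∈ targetList (t.1.1.simulate (5 * t.1.1.typeBound + 2)) t.2 a,
        u ∈ vertexList (t.1.1.simulate (3 * t.1.1.typeBound + 1)) :=
    primrecPred_forall_lt (primrec_arcLabels.comp (Primrec.fst.comp Primrec.fst))
      (primrecPred_forall_mem_list
        (primrec_targetList ((primrec_simulate_stage 5 2).comp
          (Primrec.fst.comp (Primrec.fst.comp Primrec.fst)))
          (Primrec.snd.comp Primrec.fst) Primrec.snd)
        (primrecRel_mem_list.comp Primrec.snd (primrec_vertexList.comp
          ((primrec_simulate_stage 3 1).comp
            (Primrec.fst.comp (Primrec.fst.comp (Primrec.fst.comp Primrec.fst)))))))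
  have hweights : Primrec fun t : (HRGrammar × List K) × ℕ =>
      weightList (t.1.1.simulate (5 * t.1.1.typeBound + 2)) t.1.2 t.2 :=
    primrec_weightList ((primrec_simulate_stage 5 2).comp (Primrec.fst.comp Primrec.fst))
      (Primrec.snd.comp Primrec.fst) Primrec.snd
  have hvertices : Primrec fun p : HRGrammar × List K =>
      vertexList (terminalList (p.1.simulate (2 * p.1.typeBound + 1))) :=
    primrec_vertexList.comp (primrec_terminalList.comp
      ((primrec_simulate_stage 2 1).comp Primrec.fst))
  exact (computablePred_and hdata.computablePred (computablePred_and
    (computablePred_forall_mem_list Computable.snd (computablePred_comp hmem Computable.snd))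
    (computablePred_forall_mem_list hvertices.to_comp
      (computablePred_and htargets.computablePred
        (computablePred_comp hsum hweights.to_comp))))).of_eq fun _ => isPHRInstance_iff.symm

end HRGrammar

/-! ### Fractions -/

theorem fractionValue_mem_Icc_iff (q : ℕ × ℕ) :
    fractionValue q ∈ Set.Icc (0 : ℝ) 1 ↔ q.1 ≤ q.2 + 1 := by
  have hnonneg : 0 ≤ fractionValue q := by unfold fractionValue; positivity
  rw [Set.mem_Icc, and_iff_right hnonneg, fractionValue, div_le_one (by positivity)]
  norm_cast

/-- A numerator and a denominator of the sum `∑ n * m / (d + 1)` over the entries `(n, m, d)` of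
the list; the fraction is not reduced. -/
def fractionSum (l : List (ℕ × ℕ × ℕ)) : ℕ × ℕ :=
  l.foldr (fun t s => (t.1 * t.2.1 * s.2 + s.1 * (t.2.2 + 1), s.2 * (t.2.2 + 1))) (0, 1)

theorem primrec_fractionSum : Primrec fractionSum := by
  have ht : Primrec fun p : List (ℕ × ℕ × ℕ) × (ℕ × ℕ × ℕ) × ℕ × ℕ => p.2.1 :=
    Primrec.fst.comp Primrec.snd
  have hs : Primrec fun p : List (ℕ × ℕ × ℕ) × (ℕ × ℕ × ℕ) × ℕ × ℕ => p.2.2 :=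
    Primrec.snd.comp Primrec.snd
  have hd : Primrec fun p : List (ℕ × ℕ × ℕ) × (ℕ × ℕ × ℕ) × ℕ × ℕ => p.2.1.2.2 + 1 :=
    Primrec.succ.comp (Primrec.snd.comp (Primrec.snd.comp ht))
  exact Primrec.list_foldr Primrec.id (Primrec.const (0, 1))
    ((Primrec.nat_add.comp
      (Primrec.nat_mul.comp
        (Primrec.nat_mul.comp (Primrec.fst.comp ht) (Primrec.fst.comp (Primrec.snd.comp ht)))
        (Primrec.snd.comp hs))
      (Primrec.nat_mul.comp (Primrec.fst.comp hs) hd)).pair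
    (Primrec.nat_mul.comp (Primrec.snd.comp hs) hd)).to₂

theorem fractionSum_snd_pos (l : List (ℕ × ℕ × ℕ)) : 0 < (fractionSum l).2 := by
  induction l with
  | nil => exact Nat.one_pos
  | cons t l ih => exact Nat.mul_pos ih t.2.2.succ_pos

theorem sum_fractionValue_eq_div (l : List (ℕ × ℕ × ℕ)) :
    (l.map fun t => (t.1 : ℝ) * fractionValue t.2).sum =
      ((fractionSum l).1 : ℝ) / ((fractionSum l).2 : ℝ) := by
  induction l with
  | nil => simp [fractionSum]
  | cons t l ih =>
    have hcons : fractionSum (t :: l) =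
        (t.1 * t.2.1 * (fractionSum l).2 + (fractionSum l).1 * (t.2.2 + 1),
          (fractionSum l).2 * (t.2.2 + 1)) := rfl
    have hne : ((fractionSum l).2 : ℝ) ≠ 0 := Nat.cast_ne_zero.2 (fractionSum_snd_pos l).ne'
    rw [List.map_cons, List.sum_cons, ih, hcons, fractionValue]
    push_cast
    field_simp

theorem computablePred_fractionValue_mem_Icc :
    ComputablePred fun q : ℕ × ℕ => fractionValue q ∈ Set.Icc (0 : ℝ) 1 :=
  ((Primrec.nat_le.comp Primrec.fst (Primrec.succ.comp Primrec.snd)).of_eq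
    fun q => (fractionValue_mem_Icc_iff q).symm).computablePred

theorem computablePred_sum_fractionValue_eq_one :
    ComputablePred fun l : List (ℕ × ℕ × ℕ) =>
      (l.map (fun t => (t.1 : ℝ) * fractionValue t.2)).sum = 1 :=
  ((Primrec.eq.comp (Primrec.fst.comp primrec_fractionSum)
    (Primrec.snd.comp primrec_fractionSum)).of_eq fun l => by
      rw [sum_fractionValue_eq_div, div_eq_one_iff_eq (Nat.cast_ne_zero.2
        (fractionSum_snd_pos l).ne'), Nat.cast_inj]).computablePred

theorem mainTheorem5 :
    ComputablePred (fun p : HRGrammar × List (ℕ × ℕ) => IsPHRInstance fractionValue p) ∧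
    ∀ (K : Type) [Primcodable K] (val : K → ℝ),
      ComputablePred (fun k : K => val k ∈ Set.Icc (0 : ℝ) 1) →
      ComputablePred (fun l : List (ℕ × K) =>
        (l.map (fun t => (t.1 : ℝ) * val t.2)).sum = 1) →
      ComputablePred (fun p : HRGrammar × List K => IsPHRInstance val p) :=
  ⟨HRGrammar.computablePred_isPHRInstance computablePred_fractionValue_mem_Icc
    computablePred_sum_fractionValue_eq_one,
    fun _ _ _ hmem hsum => HRGrammar.computablePred_isPHRInstance hmem hsum⟩
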